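/- There exists an absolute constant $c>0$ such that the following holds for all integers $n,d\ge 0$ and all real numbers $\tau,R>0$ and $\Lambda\ge\tau^{-2}$. Let $\mathcal M\subset\mathbb R^n$ be a closed embedded $d$-dimensional submanifold (without boundary) of class $C^2$ such that: (i) $\mathrm{reach}(\mathcal M)\ge\tau$, where the reach is the supremum of all $r\ge0$ such that every $x\in\mathbb R^n$ with $\mathrm{dist}(x,\mathcal M)\le r$ has a unique nearest point in $\mathcal M$; (ii) $\mathcal M$ is $R$-exposed, where a set $A\subset\mathbb R^n$ is called $R$-exposed if for every $p\in A$ there is a closed ball $B\subset\mathbb R^n$ of radius $R$ with $A\subset B$ and $p\in\partial B$; (iii) the second fundamental form of $\mathcal M$ is $\Lambda$-Lipschitz, i.e. $\|\mathrm{II}_x-\mathrm{II}_y\|\le\Lambda|x-y|$ for all $x,y\in\mathcal M$, where $\mathrm{II}_x$ is extended to a symmetric bilinear map $\mathbb R^n\times\mathbb R^n\to\mathbb R^n$ by setting $\mathrm{II}_x(v,w)=0$ whenever $v\in (T_x\mathcal M)^\perp$, and $\|\cdot\|$ is the operator norm of bilinear maps. Let $S\subset\mathbb R^n$ be a linear subspace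 such that $$\sup_{x\in\mathcal M}\mathrm{dist}(x,S)<c\,\Lambda^{-2}R^{-4}\tau ,$$ and let $\Pi_S:\mathbb R^n\to S$ be the orthogonal projection. Then $\Pi_S(\mathcal M)$ is $2R$-exposed. -/

import Mathlib

open Set Metric
open scoped ENNReal NNReal

noncomputable section

namespace ExposedManifold

/-- `M` is an embedded `d`-dimensional submanifold of `ℝⁿ` of class `C²` (without boundary): every
point of `M` has an open neighbourhood `W` such that `M ∩ W` is the image of an open set
`U ⊆ ℝᵈ` under a `C²` immersion `φ` that is a homeomorphism of `U` onto `M ∩ W`, with continuous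
inverse `ψ`. -/
def IsC2Submanifold (d : ℕ) {n : ℕ} (M : Set (EuclideanSpace ℝ (Fin n))) : Prop :=
  ∀ p ∈ M, ∃ (W : Set (EuclideanSpace ℝ (Fin n))) (U : Set (EuclideanSpace ℝ (Fin d)))
    (φ : EuclideanSpace ℝ (Fin d) → EuclideanSpace ℝ (Fin n))
    (ψ : EuclideanSpace ℝ (Fin n) → EuclideanSpace ℝ (Fin d)),
    IsOpen W ∧ p ∈ W ∧ IsOpen U ∧ ContDiffOn ℝ 2 φ U ∧
    (∀ u ∈ U, Function.Injective (fderiv ℝ φ u)) ∧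
    φ '' U = M ∩ W ∧ ContinuousOn ψ (M ∩ W) ∧ ∀ u ∈ U, ψ (φ u) = u

/-- The tangent space `T_p M`, as a linear subspace of `ℝⁿ`: the span of all tangent directions to
`M` at `p`. (For a submanifold the tangent directions already form a linear subspace, the range of
the differential of any local parametrization.) -/
def tangentSpace {n : ℕ} (M : Set (EuclideanSpace ℝ (Fin n))) (p : EuclideanSpace ℝ (Fin n)) :
    Submodule ℝ (EuclideanSpace ℝ (Fin n)) :=
  Submodule.span ℝ (tangentConeAt ℝ M p)

/-- The orthogonal projection `Π_p` of `ℝⁿ` onto `T_p M`. -/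
def tangentProj {n : ℕ} (M : Set (EuclideanSpace ℝ (Fin n))) (p : EuclideanSpace ℝ (Fin n)) :
    EuclideanSpace ℝ (Fin n) →L[ℝ] EuclideanSpace ℝ (Fin n) :=
  (tangentSpace M p).starProjection

/-- The orthogonal projection of `ℝⁿ` onto the normal space `(T_p M)ᗮ`. -/
def normalProj {n : ℕ} (M : Set (EuclideanSpace ℝ (Fin n))) (p : EuclideanSpace ℝ (Fin n)) :
    EuclideanSpace ℝ (Fin n) →L[ℝ] EuclideanSpace ℝ (Fin n) :=
  (tangentSpace M p)ᗮ.starProjection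

/-- The second fundamental form of `M` at `p`. For `v, w ∈ T_p M` its value is the normal component
of the derivative at `p`, in the direction `v`, of a tangent vector field on `M` that takes the
value `w` at `p`; the field used here is `q ↦ Π_q w`, whose derivative along `M` is taken with
`fderivWithin` (only its values on tangent directions, which are uniquely determined, enter).
The form is extended to `ℝⁿ × ℝⁿ` by composing both arguments with `Π_p`, that is, by zero on
normal vectors. -/
def secondFundamentalForm {n : ℕ} (M : Set (EuclideanSpace ℝ (Fin n)))
    (p : EuclideanSpace ℝ (Fin n)) :
    EuclideanSpace ℝ (Fin n) →L[ℝ] EuclideanSpace ℝ (Fin n) →L[ℝ] EuclideanSpace ℝ (Fin n) :=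
  (ContinuousLinearMap.compL ℝ (EuclideanSpace ℝ (Fin n)) (EuclideanSpace ℝ (Fin n))
      (EuclideanSpace ℝ (Fin n)) (normalProj M p)).comp
    ((fderivWithin ℝ (tangentProj M) M p).bilinearComp (tangentProj M p) (tangentProj M p))

theorem secondFundamentalForm_apply {n : ℕ} (M : Set (EuclideanSpace ℝ (Fin n)))
    (p v w : EuclideanSpace ℝ (Fin n)) :
    secondFundamentalForm M p v w =
      normalProj M p
        (fderivWithin ℝ (tangentProj M) M p (tangentProj M p v) (tangentProj M p w)) :=
  rfl

/-- The second fundamental form of `M` (extended to `ℝⁿ × ℝⁿ`) is `Λ`-Lipschitz on `M` for the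
operator norm of bilinear maps. -/
def HasLipschitzSecondFundamentalForm {n : ℕ} (Λ : ℝ) (M : Set (EuclideanSpace ℝ (Fin n))) :
    Prop :=
  ∀ x ∈ M, ∀ y ∈ M,
    ‖secondFundamentalForm M x - secondFundamentalForm M y‖ ≤ Λ * ‖x - y‖

/-- The reach of `A`: the supremum (in `[0, ∞]`) of all `r ≥ 0` such that every point at distance at
most `r` from `A` has a unique nearest point in `A`. -/
def reach {n : ℕ} (A : Set (EuclideanSpace ℝ (Fin n))) : ℝ≥0∞ :=
  ⨆ (r : ℝ≥0) (_ : ∀ x : EuclideanSpace ℝ (Fin n), infEDist x A ≤ r →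
    ∃! q, q ∈ A ∧ ∀ q' ∈ A, dist x q ≤ dist x q'), (r : ℝ≥0∞)

/-- `M` is `R`-exposed: for every `p ∈ M` there is a closed ball of radius `R` in `ℝⁿ` that contains
`M` and has `p` on its boundary. -/
def IsExposed {n : ℕ} (R : ℝ) (M : Set (EuclideanSpace ℝ (Fin n))) : Prop :=
  ∀ p ∈ M, ∃ z : EuclideanSpace ℝ (Fin n), M ⊆ closedBall z R ∧ p ∈ frontier (closedBall z R)

end ExposedManifold

end

/-! Fix `p` in `M` and let `ν` point from `p` to the centre of the exposing ball, so `‖ν‖ = R` and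
`‖x - p‖² ≤ 2⟪ν, x - p⟫` on `M`; in particular `ν` is normal at `p`. It suffices to find `N ∈ S`
with `‖N‖ ≤ R` and `⟪ν - N, x - p⟫ ≤ ‖x - p‖² / 4` on `M`: then `‖x - p‖² ≤ 4⟪N, x - p⟫`, and
projecting to `S` only shrinks the left side, which gives a ball of radius `2R`. The plain
projection of `ν` to `S` need not work, because its error may have a first-order term along `T_p M`;
`exists_normal_mem_subspace` subtracts a small vector `s` to make `N` normal at `p` as well.

The error is estimated at a scale `h` comparable to `1 / (RΛ)` (`exists_closedBall_projection`). If
`‖x - p‖ > h`, closeness of `p` and `x` to `S` bounds it by `2Rε + ‖s‖‖x - p‖`. If `‖x - p‖ ≤ h`,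
only the normal part of `x - p` matters, and this is `II_p(x - p, x - p) / 2` up to `O(Λ‖x - p‖³)`.
The form itself nearly takes values in `S`: for tangent `v`, both `p ± v + II_p(v, v) / 2` are near
`M`, hence near `S`; their sum isolates `II_p(v, v)` and their difference isolates `v`.

The Taylor expansion (`norm_nearest_expansion_le`) must be quantitative although `M` is only `C²`.
The reach yields Federer's chord bound (`hasTangentBound_of_reach`), from which `T_p M` is shown to
be Lipschitz in `p`. The expansion then follows the nearest point `ξ t` of `M` to `p + t v`: its
velocity is almost `Π_{ξ t} v`, the normal part of that velocity is almost `t • II_p(v, v)`, and two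
applications of a mean value inequality integrate this. The assumption `Λ ≥ τ⁻²` absorbs the errors
of order `‖v‖³ / τ²`. -/

noncomputable section

namespace ExposedManifold

open Filter Topology

/-! ### Local left inverses of immersions; projection onto the range of an injective map -/

section Retraction

variable {F E : Type*} [NormedAddCommGroup F] [InnerProductSpace ℝ F] [FiniteDimensional ℝ F]
  [NormedAddCommGroup E] [InnerProductSpace ℝ E] [FiniteDimensional ℝ E]

/-- An immersion has a local left inverse defined on the ambient space. -/
theorem exists_local_left_inverse {φ : F → E} {u₀ : F} (hφ : ContDiffAt ℝ 2 φ u₀)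
    (hinj : Function.Injective (fderiv ℝ φ u₀)) :
    ∃ ρ : E → F, DifferentiableAt ℝ ρ (φ u₀) ∧ ∀ᶠ u in 𝓝 u₀, ρ (φ u) = u := by
  obtain ⟨A, hA⟩ := (fderiv ℝ φ u₀).toLinearMap.exists_leftInverse_of_injective
    (LinearMap.ker_eq_bot.2 hinj)
  let A' : E →L[ℝ] F := LinearMap.toContinuousLinearMap A
  have h1 : HasStrictFDerivAt φ (fderiv ℝ φ u₀) u₀ := hφ.hasStrictFDerivAt (by norm_num)
  have h2 : HasStrictFDerivAt (fun u => A' (φ u))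
      ((ContinuousLinearEquiv.refl ℝ F : F ≃L[ℝ] F) : F →L[ℝ] F) u₀ := by
    have := A'.hasStrictFDerivAt.comp u₀ h1
    convert this using 1
    ext v
    exact (LinearMap.congr_fun hA v).symm
  refine ⟨fun x => h2.localInverse _ _ _ (A' x), ?_, h2.eventually_left_inverse⟩
  exact DifferentiableAt.comp (φ u₀) (h2.to_localInverse.differentiableAt) A'.differentiableAt

/-- The adjoint as a continuous `ℝ`-linear map. -/
def realAdjoint : (F →L[ℝ] E) →L[ℝ] (E →L[ℝ] F) :=
  LinearMap.mkContinuous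
    { toFun := fun L => ContinuousLinearMap.adjoint L
      map_add' := fun L L' => map_add _ L L'
      map_smul' := fun c L => by simp } 1 (fun L => by simp)

theorem isUnit_adjoint_comp_self {L : F →L[ℝ] E} (hL : Function.Injective L) :
    IsUnit ((realAdjoint L).comp L) := by
  rw [ContinuousLinearMap.isUnit_iff_bijective]
  have hi : Function.Injective ((realAdjoint L).comp L) := by
    rw [injective_iff_map_eq_zero]
    intro v hv
    have : inner ℝ (L v) (L v) = 0 := by
      rw [← ContinuousLinearMap.adjoint_inner_right]
      change inner ℝ v (((realAdjoint L).comp L) v) = 0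
      rw [hv, inner_zero_right]
    exact hL (by rw [map_zero]; exact inner_self_eq_zero.1 this)
  exact ⟨hi, LinearMap.injective_iff_surjective (f := ((realAdjoint L).comp L).toLinearMap) |>.1 hi⟩

/-- The least-squares formula `L (L* L)⁻¹ L*`. It is smooth in `L`, which turns differentiability of
the differential of a parametrization into differentiability of the tangent projection. -/
theorem starProjection_range_eq {L : F →L[ℝ] E} (hL : Function.Injective L) :
    (LinearMap.range L.toLinearMap).starProjection =
      L.comp ((Ring.inverse ((realAdjoint L).comp L)).comp (realAdjoint L)) := by
  ext1 x
  refine Submodule.eq_starProjection_of_mem_of_inner_eq_zero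
    (K := LinearMap.range L.toLinearMap)
    (u := x) (v := L (Ring.inverse ((realAdjoint L).comp L) (realAdjoint L x))) ⟨_, rfl⟩ ?_
  rintro _ ⟨v, rfl⟩
  change inner ℝ (x - L _) (L v) = 0
  rw [← ContinuousLinearMap.adjoint_inner_left, map_sub]
  have := congrArg (fun f : F →L[ℝ] F => f (realAdjoint L x))
    (Ring.mul_inverse_cancel _ (isUnit_adjoint_comp_self hL))
  change realAdjoint L (L (Ring.inverse ((realAdjoint L).comp L) (realAdjoint L x)))
    = realAdjoint L x at this
  change inner ℝ (realAdjoint L x -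
    realAdjoint L (L (Ring.inverse ((realAdjoint L).comp L) (realAdjoint L x)))) v = 0
  rw [this, sub_self, inner_zero_left]

theorem differentiableAt_starProjection_range {L : F → F →L[ℝ] E} {u : F}
    (hL : DifferentiableAt ℝ L u) (hinj : Function.Injective (L u)) :
    DifferentiableAt ℝ (fun w => (L w).comp
      ((Ring.inverse ((realAdjoint (L w)).comp (L w))).comp (realAdjoint (L w)))) u := by
  have hadj : DifferentiableAt ℝ (fun w => realAdjoint (L w)) u :=
    (realAdjoint (F := F) (E := E)).differentiableAt.comp u hL
  have hi : DifferentiableAt ℝ (fun w => Ring.inverse ((realAdjoint (L w)).comp (L w))) u :=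
    (differentiableAt_inverse (isUnit_adjoint_comp_self hinj)).comp
      (f := fun w => (realAdjoint (L w)).comp (L w)) u (hadj.clm_comp hL)
  exact hL.clm_comp (hi.clm_comp hadj)

end Retraction

/-! ### Local structure of `C²` submanifolds -/

section Submanifold

variable {d n : ℕ} {M : Set (EuclideanSpace ℝ (Fin n))} {p : EuclideanSpace ℝ (Fin n)}

/-- Around each of its points a `C²` submanifold is the image of an immersion with a local left
inverse defined on the ambient space, whose differential parametrizes the tangent spaces. -/
theorem IsC2Submanifold.exists_parametrization (hM : IsC2Submanifold d M) (hp : p ∈ M) :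
    ∃ (φ : EuclideanSpace ℝ (Fin d) → EuclideanSpace ℝ (Fin n))
      (ρ : EuclideanSpace ℝ (Fin n) → EuclideanSpace ℝ (Fin d)),
      φ (ρ p) = p ∧ DifferentiableAt ℝ ρ p ∧ (∀ᶠ q in 𝓝[M] p, φ (ρ q) = q) ∧
      ∀ᶠ u in 𝓝 (ρ p), φ u ∈ M ∧ ContDiffAt ℝ 2 φ u ∧ Function.Injective (fderiv ℝ φ u) ∧
        tangentSpace M (φ u) = LinearMap.range (fderiv ℝ φ u).toLinearMap := by
  obtain ⟨W, U, φ, ψ, hW, hpW, hU, hφ, hinj, him, hψ, hleft⟩ := hM p hp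
  have hsmooth : ∀ u ∈ U, ContDiffAt ℝ 2 φ u := fun u hu => hφ.contDiffAt (hU.mem_nhds hu)
  have hmem : ∀ u ∈ U, φ u ∈ M ∩ W := fun u hu => him ▸ mem_image_of_mem φ hu
  have hret : ∀ u ∈ U, ∃ ρ : EuclideanSpace ℝ (Fin n) → EuclideanSpace ℝ (Fin d),
      ρ (φ u) = u ∧ DifferentiableAt ℝ ρ (φ u) ∧ ∀ᶠ q in 𝓝[M] (φ u), φ (ρ q) = q := by
    intro u hu
    obtain ⟨ρ, hρ, hev⟩ := exists_local_left_inverse (hsmooth u hu) (hinj u hu)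
    refine ⟨ρ, hev.self_of_nhds, hρ, ?_⟩
    have hW' : W ∈ 𝓝 (φ u) := hW.mem_nhds (hmem u hu).2
    -- The chart inverse `ψ` is only continuous. That is enough to bring `ψ q` into the
    -- neighbourhood where `ρ` inverts `φ`; the differentiability comes from `ρ`.
    have hψt : Tendsto ψ (𝓝[M] (φ u)) (𝓝 u) := by
      have := hψ (φ u) (hmem u hu)
      rw [ContinuousWithinAt, hleft u hu, nhdsWithin_inter_of_mem'
        (mem_nhdsWithin_of_mem_nhds hW')] at this
      exact this
    filter_upwards [hψt.eventually hev, self_mem_nhdsWithin, mem_nhdsWithin_of_mem_nhds hW']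
      with q hq hqM hqW
    obtain ⟨w, hw, rfl⟩ : q ∈ φ '' U := him ▸ ⟨hqM, hqW⟩
    rw [hleft w hw] at hq
    rw [hq]
  have htan : ∀ u ∈ U, tangentSpace M (φ u) = LinearMap.range (fderiv ℝ φ u).toLinearMap := by
    intro u hu
    have hd : HasFDerivAt φ (fderiv ℝ φ u) u :=
      ((hsmooth u hu).differentiableAt (by norm_num)).hasFDerivAt
    apply le_antisymm
    · obtain ⟨ρ, hρu, hρ, hev⟩ := hret u hu
      refine Submodule.span_le.2 fun y hy => ?_
      -- Near `φ u` the map `φ ∘ ρ` is the identity on `M`, so its derivative fixes every tangent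
      -- direction, which therefore lies in the range of the differential of `φ`.
      have h1 : HasFDerivWithinAt (fun q => φ (ρ q))
          ((fderiv ℝ φ u).comp (fderiv ℝ ρ (φ u))) M (φ u) := by
        apply HasFDerivAt.hasFDerivWithinAt
        refine HasFDerivAt.comp (φ u) ?_ hρ.hasFDerivAt
        rw [hρu]; exact hd
      have h2 : HasFDerivWithinAt (fun q => φ (ρ q))
          (ContinuousLinearMap.id ℝ (EuclideanSpace ℝ (Fin n))) M (φ u) :=
        (hasFDerivWithinAt_id (φ u) M).congr_of_eventuallyEq hev (by simp [hρu])
      have := h1.unique_on h2 hy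
      exact ⟨fderiv ℝ ρ (φ u) y, this⟩
    · rintro _ ⟨w, rfl⟩
      have hw : w ∈ tangentConeAt ℝ U u := by
        rw [(hU.mem_nhds hu : U ∈ 𝓝 u) |> tangentConeAt_of_mem_nhds]; trivial
      have h1 := hd.hasFDerivWithinAt (s := U) |>.mapsTo_tangent_cone hw
      exact Submodule.subset_span (tangentConeAt_mono (fun x hx => by
        obtain ⟨y, hy, rfl⟩ := hx; exact (hmem y hy).1) h1)
  obtain ⟨u, hu, rfl⟩ : p ∈ φ '' U := him ▸ ⟨hp, hpW⟩
  obtain ⟨ρ, hρu, hρ, hev⟩ := hret u hu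
  refine ⟨φ, ρ, by rw [hρu], hρ, hev, ?_⟩
  rw [hρu]
  filter_upwards [hU.mem_nhds hu] with w hw
  exact ⟨(hmem w hw).1, hsmooth w hw, hinj w hw, htan w hw⟩

/-- Every tangent vector is the velocity of a curve in the submanifold. -/
theorem IsC2Submanifold.exists_curve (hM : IsC2Submanifold d M) (hp : p ∈ M)
    {v : EuclideanSpace ℝ (Fin n)} (hv : v ∈ tangentSpace M p) :
    ∃ γ : ℝ → EuclideanSpace ℝ (Fin n), γ 0 = p ∧ HasDerivAt γ v 0 ∧ ∀ᶠ t in 𝓝 0, γ t ∈ M := by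
  obtain ⟨φ, ρ, hφρ, hρ, hret, hev⟩ := hM.exists_parametrization hp
  obtain ⟨-, hs, -, hT⟩ := hev.self_of_nhds
  rw [hφρ] at hT
  rw [hT] at hv
  obtain ⟨w, rfl⟩ := hv
  have hline : HasDerivAt (fun t : ℝ => ρ p + t • w) w 0 := by
    simpa using ((hasDerivAt_id (0 : ℝ)).smul_const w).const_add (ρ p)
  refine ⟨fun t => φ (ρ p + t • w), by simp [hφρ], ?_, ?_⟩
  · refine HasFDerivAt.comp_hasDerivAt (f := fun t : ℝ => ρ p + t • w) 0 ?_ hline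
    simpa using (hs.differentiableAt (by norm_num)).hasFDerivAt
  · have : Tendsto (fun t : ℝ => ρ p + t • w) (𝓝 0) (𝓝 (ρ p)) := by
      simpa using hline.continuousAt.tendsto
    filter_upwards [this.eventually hev] with t ht using ht.1

/-- On `M` near `p`, the tangent projection is the least-squares formula evaluated at `fderiv ℝ φ (ρ
q)`, a composition of differentiable maps of the ambient point `q`. -/
theorem IsC2Submanifold.differentiableWithinAt_tangentProj (hM : IsC2Submanifold d M)
    (hp : p ∈ M) : DifferentiableWithinAt ℝ (tangentProj M) M p := by
  obtain ⟨φ, ρ, hφρ, hρ, hret, hev⟩ := hM.exists_parametrization hp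
  obtain ⟨-, hs, hinj, hT⟩ := hev.self_of_nhds
  have hL : DifferentiableAt ℝ (fderiv ℝ φ) (ρ p) :=
    (hs.fderiv_right (m := 1) (by norm_num)).differentiableAt (by norm_num)
  have hd := (differentiableAt_starProjection_range hL hinj).comp p hρ
  have heq : ∀ q, φ (ρ q) = q → Function.Injective (fderiv ℝ φ (ρ q)) →
      tangentSpace M (φ (ρ q)) = LinearMap.range (fderiv ℝ φ (ρ q)).toLinearMap →
      tangentProj M q = (fderiv ℝ φ (ρ q)).comp ((Ring.inverse ((realAdjoint
        (fderiv ℝ φ (ρ q))).comp (fderiv ℝ φ (ρ q)))).comp (realAdjoint (fderiv ℝ φ (ρ q)))) := by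
    intro q hq hi ht
    rw [← starProjection_range_eq hi, tangentProj]
    rw [hq] at ht
    simp only [ht]
  refine hd.differentiableWithinAt.congr_of_eventuallyEq ?_ (heq p hφρ hinj hT)
  filter_upwards [hret, mem_nhdsWithin_of_mem_nhds (hρ.continuousAt.eventually hev)] with q hq h
  exact heq q hq h.2.2.1 h.2.2.2

/-- A `C²` submanifold has a contact of order two with its tangent spaces. -/
theorem IsC2Submanifold.exists_norm_normalProj_le (hM : IsC2Submanifold d M) (hp : p ∈ M) :
    ∃ C > 0, ∀ᶠ q in 𝓝[M] p, ‖normalProj M p (q - p)‖ ≤ C * ‖q - p‖ ^ 2 := by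
  obtain ⟨φ, ρ, hφρ, hρ, hret, hev⟩ := hM.exists_parametrization hp
  obtain ⟨-, hs, hinj, hT⟩ := hev.self_of_nhds
  rw [hφρ] at hT
  have hL : ContDiffAt ℝ 1 (fderiv ℝ φ) (ρ p) := hs.fderiv_right (by norm_num)
  obtain ⟨K, t, ht, hK⟩ := hL.exists_lipschitzOnWith
  obtain ⟨r, hr, hball⟩ := Metric.mem_nhds_iff.1 (inter_mem ht hev)
  have hquad : ∀ u ∈ ball (ρ p) r,
      ‖φ u - φ (ρ p) - fderiv ℝ φ (ρ p) (u - ρ p)‖ ≤ K * ‖u - ρ p‖ ^ 2 := by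
    intro u hu
    have hseg : ∀ w ∈ segment ℝ (ρ p) u, ‖fderiv ℝ φ w - fderiv ℝ φ (ρ p)‖ ≤ K * ‖u - ρ p‖ := by
      intro w hw
      have hwb : w ∈ ball (ρ p) r := (convex_ball _ _).segment_subset (mem_ball_self hr) hu hw
      have h1 := hK.dist_le_mul w (hball hwb).1 (ρ p) (hball (mem_ball_self hr)).1
      rw [dist_eq_norm, dist_eq_norm] at h1
      refine h1.trans (mul_le_mul_of_nonneg_left ?_ K.2)
      exact norm_sub_le_of_mem_segment hw
    have := (convex_segment (ρ p) u).norm_image_sub_le_of_norm_hasFDerivWithin_le'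
      (f := φ) (f' := fderiv ℝ φ) (φ := fderiv ℝ φ (ρ p)) (C := K * ‖u - ρ p‖)
      (fun w hw => (((hball ((convex_ball _ _).segment_subset (mem_ball_self hr) hu hw)).2.2.1
        ).differentiableAt (by norm_num)).hasFDerivAt.hasFDerivWithinAt)
      hseg (left_mem_segment ℝ _ _) (right_mem_segment ℝ _ _)
    linarith [this, sq ‖u - ρ p‖, mul_assoc (K : ℝ) ‖u - ρ p‖ ‖u - ρ p‖]
  obtain ⟨B, hB⟩ := hρ.isBigO_sub.bound
  refine ⟨K * B ^ 2 + 1, by positivity, ?_⟩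
  filter_upwards [hret, mem_nhdsWithin_of_mem_nhds hB, mem_nhdsWithin_of_mem_nhds
    (hρ.continuousAt.eventually (ball_mem_nhds _ hr))] with q hq hqB hqr
  have h1 := hquad _ hqr
  rw [hq, hφρ] at h1
  have h2 : normalProj M p (fderiv ℝ φ (ρ p) (ρ q - ρ p)) = 0 := by
    apply Submodule.starProjection_orthogonal_apply_eq_zero
    rw [hT]; exact ⟨_, rfl⟩
  have h3 : normalProj M p (q - p) =
      normalProj M p (q - p - fderiv ℝ φ (ρ p) (ρ q - ρ p)) := by
    rw [map_sub _ (q - p), h2, sub_zero]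
  rw [h3]
  have h4 : ‖ρ q - ρ p‖ ^ 2 ≤ B ^ 2 * ‖q - p‖ ^ 2 := by
    rw [← mul_pow]; exact pow_le_pow_left₀ (norm_nonneg _) hqB 2
  calc _ ≤ _ := Submodule.norm_starProjection_apply_le _ _
    _ ≤ K * ‖ρ q - ρ p‖ ^ 2 := h1
    _ ≤ K * (B ^ 2 * ‖q - p‖ ^ 2) := mul_le_mul_of_nonneg_left h4 K.2
    _ ≤ _ := by nlinarith [sq_nonneg ‖q - p‖]

end Submanifold

/-! ### Unique nearest points and empty tangent balls -/

section Reach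

variable {E : Type*} [NormedAddCommGroup E] [InnerProductSpace ℝ E] {M : Set E}

theorem norm_sub_sq_le_of_infDist_eq {y p q : E} (h : infDist y M = dist y p) (hq : q ∈ M) :
    2 * inner ℝ (y - p) (q - p) ≤ ‖q - p‖ ^ 2 := by
  have h1 : ‖y - p‖ ≤ ‖(y - p) - (q - p)‖ := by
    rw [sub_sub_sub_cancel_right, ← dist_eq_norm, ← dist_eq_norm, ← h]
    exact infDist_le_dist_of_mem hq
  have h2 := pow_le_pow_left₀ (norm_nonneg _) h1 2
  rw [norm_sub_sq_real (y - p) (q - p)] at h2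
  linarith

variable [FiniteDimensional ℝ E]

/-- At a point off `M` with a unique nearest point, the distance to `M` grows at unit speed in the
direction that leads away from the nearest point. -/
theorem eventually_lt_infDist (hM : IsClosed M) {x ξ : E} (hξ : ξ ∈ M)
    (hd : infDist x M = dist x ξ) (hpos : 0 < infDist x M)
    (huniq : ∀ q ∈ M, dist x q = infDist x M → q = ξ) {η : ℝ} (hη : 0 < η) (hη1 : η < 1) :
    ∀ᶠ t in 𝓝[>] (0 : ℝ), infDist x M + (1 - η) * t <
      infDist (x + t • ((infDist x M)⁻¹ • (x - ξ))) M := by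
  have : ProperSpace E := FiniteDimensional.proper_real E
  set δ := infDist x M with hδ
  set ν : E := δ⁻¹ • (x - ξ) with hν
  have hνn : ‖ν‖ = 1 := by
    rw [hν, norm_smul, norm_inv, Real.norm_of_nonneg hpos.le, ← dist_eq_norm, ← hd,
      inv_mul_cancel₀ hpos.ne']
  have hνi : inner ℝ ν (x - ξ) = δ := by
    rw [hν, real_inner_smul_left, real_inner_self_eq_norm_sq, ← dist_eq_norm, ← hd]
    field_simp
  -- `K` collects the points of `M` seen from `x` in a direction far from that of `ξ`. Uniqueness of
  -- `ξ` makes them farther than `δ` by a fixed gap `m`, so for `t < m / 2` the nearest point of `x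
  -- + t • ν` lies outside `K`.
  let K : Set E := {q ∈ M | inner ℝ ν (x - q) ≤ δ * (1 - η / 2)}
  have hKc : IsClosed K := by
    exact hM.inter (show IsClosed {q | inner ℝ ν (x - q) ≤ δ * (1 - η / 2)} from
      isClosed_le (by fun_prop) continuous_const)
  obtain ⟨m, hm, hKm⟩ : ∃ m > 0, ∀ q ∈ K, δ + m ≤ dist x q := by
    rcases K.eq_empty_or_nonempty with hK | hK
    · exact ⟨1, one_pos, by simp [hK]⟩
    obtain ⟨q₀, hq₀, hq₀d⟩ := hKc.exists_infDist_eq_dist hK x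
    have h1 : δ < dist x q₀ := by
      refine lt_of_le_of_ne (infDist_le_dist_of_mem hq₀.1) fun h => ?_
      have h2 := hq₀.2
      rw [huniq q₀ hq₀.1 h.symm, hνi] at h2
      nlinarith
    exact ⟨dist x q₀ - δ, by linarith, fun q hq => by
      have := infDist_le_dist_of_mem (x := x) hq
      linarith⟩
  have hlim : ∀ᶠ t in 𝓝[>] (0 : ℝ), t ∈ Ioo 0 (m / 2) :=
    Ioo_mem_nhdsGT (by positivity)
  filter_upwards [hlim] with t ht
  obtain ⟨ht0, htm⟩ := ht
  obtain ⟨q, hq, hqd⟩ := hM.exists_infDist_eq_dist ⟨ξ, hξ⟩ (x + t • ν)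
  have htν : dist (x + t • ν) x = t := by
    rw [dist_eq_norm, add_sub_cancel_left, norm_smul, hνn, Real.norm_of_nonneg ht0.le, mul_one]
  have hqK : q ∉ K := by
    intro hqK
    have h1 := hKm q hqK
    have h2 : dist (x + t • ν) q ≤ dist (x + t • ν) ξ := hqd ▸ infDist_le_dist_of_mem hξ
    have h3 := dist_triangle x (x + t • ν) q
    have h4 := dist_triangle (x + t • ν) x ξ
    rw [dist_comm x (x + t • ν)] at h3
    linarith
  have hqi : δ * (1 - η / 2) < inner ℝ ν (x - q) := by
    by_contra h
    exact hqK ⟨hq, not_lt.1 h⟩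
  rw [hqd, dist_eq_norm]
  have hxq : δ ≤ ‖x - q‖ := by rw [← dist_eq_norm]; exact infDist_le_dist_of_mem hq
  have hexp : ‖x + t • ν - q‖ ^ 2 = ‖x - q‖ ^ 2 + 2 * (t * inner ℝ ν (x - q)) + t ^ 2 := by
    rw [show x + t • ν - q = (x - q) + t • ν by abel, norm_add_sq_real, real_inner_smul_right,
      real_inner_comm, norm_smul, hνn, Real.norm_of_nonneg ht0.le, mul_one]
  refine lt_of_pow_lt_pow_left₀ 2 (norm_nonneg _) ?_
  rw [hexp]
  have h5 : δ ^ 2 ≤ ‖x - q‖ ^ 2 := pow_le_pow_left₀ hpos.le hxq 2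
  have h6 : t * (δ * (1 - η / 2)) < t * inner ℝ ν (x - q) := mul_lt_mul_of_pos_left hqi ht0
  have h7 : 0 < t * δ * η := by positivity
  have h8 : 0 ≤ t ^ 2 * (η * (2 - η)) := by
    have : 0 ≤ 2 - η := by linarith
    positivity
  linarith

/-- If all points within distance `r` of `M` have a unique nearest point, the ball of radius `r`
touching `M` at `p` from the side of a point `y` that `p` is nearest to does not meet `M` in its
interior. -/
theorem inner_le_of_unique_nearest (hM : IsClosed M) {r : ℝ} (hr : 0 < r)
    (huniq : ∀ x, infDist x M ≤ r → ∃! q, q ∈ M ∧ ∀ q' ∈ M, dist x q ≤ dist x q')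
    {y p : E} (hp : p ∈ M) (hy : infDist y M = dist y p) {q : E} (hq : q ∈ M) :
    inner ℝ (y - p) (q - p) ≤ ‖y - p‖ * ‖q - p‖ ^ 2 / (2 * r) := by
  have : ProperSpace E := FiniteDimensional.proper_real E
  set s := ‖y - p‖ with hs
  have hys : infDist y M = s := by rw [hy, dist_eq_norm]
  have hbasic := norm_sub_sq_le_of_infDist_eq hy hq
  rw [le_div_iff₀ (by positivity)]
  rcases (norm_nonneg (y - p)).eq_or_lt with h0 | hs0
  · rw [norm_eq_zero.1 h0.symm, inner_zero_left, zero_mul]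
    positivity
  rw [← hs] at hs0
  rcases le_or_gt r s with hrs | hrs
  · rcases le_or_gt (inner ℝ (y - p) (q - p)) 0 with hi | hi
    · have : 0 ≤ s * ‖q - p‖ ^ 2 := by positivity
      nlinarith
    · nlinarith [sq_nonneg ‖q - p‖]
  have hρ : 0 < r - s := by linarith
  have hcomp : IsCompact (closedBall y (r - s)) := isCompact_closedBall _ _
  have hne : (closedBall y (r - s)).Nonempty := ⟨y, mem_closedBall_self hρ.le⟩
  obtain ⟨x₁, hx₁, hmax⟩ := hcomp.exists_isMaxOn hne (continuous_infDist_pt M).continuousOn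
  have hx₁r : r ≤ infDist x₁ M := by
    -- In place of a flow along the gradient of the distance, the distance is maximized with penalty
    -- `(1 - η) * dist x y`. An interior maximizer could be moved away from its nearest point at a
    -- gain, so the maximizer lies on the sphere.
    have key : ∀ η ∈ Ioo (0 : ℝ) 1, s + (1 - η) * (r - s) ≤ infDist x₁ M := by
      rintro η ⟨hη, hη1⟩
      have hg : Continuous fun x => infDist x M - (1 - η) * dist x y := by
        fun_prop
      obtain ⟨x₀, hx₀, hmax₀⟩ := hcomp.exists_isMaxOn hne hg.continuousOn
      have hy0 := hmax₀ (mem_closedBall_self hρ.le)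
      simp only [mem_ofPred_eq, dist_self, mul_zero, sub_zero, hys] at hy0
      have hx₀' : dist x₀ y ≤ r - s := hx₀
      rcases hx₀'.eq_or_lt with heq | hlt
      · have h1 : infDist x₀ M ≤ infDist x₁ M := hmax hx₀
        rw [heq] at hy0
        linarith
      exfalso
      have hpos : 0 < infDist x₀ M := by
        have : 0 ≤ (1 - η) * dist x₀ y := mul_nonneg (by linarith) dist_nonneg
        linarith
      have hle : infDist x₀ M ≤ r := by
        have := infDist_le_infDist_add_dist (s := M) (x := x₀) (y := y)
        linarith
      obtain ⟨ξ, ⟨hξ, hξm⟩, hξu⟩ := huniq x₀ hle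
      have hξd : infDist x₀ M = dist x₀ ξ :=
        le_antisymm (infDist_le_dist_of_mem hξ) ((le_infDist ⟨p, hp⟩).2 fun {z} hz => hξm z hz)
      have hev := eventually_lt_infDist hM hξ hξd hpos (fun z hz hzd => hξu z ⟨hz, fun z' hz' => by
        rw [hzd]; exact infDist_le_dist_of_mem hz'⟩) hη hη1
      have hlim : ∀ᶠ t in 𝓝[>] (0 : ℝ), t ∈ Ioo 0 (r - s - dist x₀ y) :=
        Ioo_mem_nhdsGT (by linarith)
      obtain ⟨t, ht, ht0, ht1⟩ := (hev.and hlim).exists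
      have hstep : dist (x₀ + t • ((infDist x₀ M)⁻¹ • (x₀ - ξ))) x₀ = t := by
        rw [dist_eq_norm, add_sub_cancel_left, norm_smul, norm_smul, norm_inv,
          Real.norm_of_nonneg hpos.le, ← dist_eq_norm, ← hξd, inv_mul_cancel₀ hpos.ne',
          Real.norm_of_nonneg ht0.le, mul_one]
      have htri := dist_triangle (x₀ + t • ((infDist x₀ M)⁻¹ • (x₀ - ξ))) x₀ y
      have h2 := hmax₀ (show x₀ + t • ((infDist x₀ M)⁻¹ • (x₀ - ξ)) ∈ closedBall y (r - s) by
        rw [mem_closedBall]; linarith)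
      simp only [mem_ofPred_eq] at h2
      nlinarith
    have hlim : Tendsto (fun η : ℝ => s + (1 - η) * (r - s)) (𝓝[>] 0) (𝓝 (s + (1 - 0) * (r - s))) :=
      (Continuous.tendsto (by fun_prop) 0).mono_left nhdsWithin_le_nhds
    have := le_of_tendsto hlim (by
      filter_upwards [Ioo_mem_nhdsGT (zero_lt_one' ℝ)] with η hη using key η hη)
    linarith
  have hx₁y : ‖x₁ - y‖ ≤ r - s := by rw [← dist_eq_norm]; exact hx₁
  have hx₁p : r ≤ ‖x₁ - p‖ := by
    rw [← dist_eq_norm]; exact hx₁r.trans (infDist_le_dist_of_mem hp)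
  have hx₁q : r ≤ ‖x₁ - q‖ := by
    rw [← dist_eq_norm]; exact hx₁r.trans (infDist_le_dist_of_mem hq)
  -- Equality case of the triangle inequality: `‖x₁ - p‖ ≥ r`, while `x₁` is within `r - s` of `y`
  -- and `‖y - p‖ = s`. So `x₁` lies on the ray from `p` through `y`, and the ball of radius `r`
  -- about it is the touching ball.
  have hcol : s • (x₁ - y) = (r - s) • (y - p) := by
    have h1 : ‖x₁ - p‖ ^ 2 = ‖x₁ - y‖ ^ 2 + 2 * inner ℝ (x₁ - y) (y - p) + s ^ 2 := by
      rw [← sub_add_sub_cancel x₁ y p, norm_add_sq_real]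
    have h2 : r ^ 2 ≤ ‖x₁ - p‖ ^ 2 := pow_le_pow_left₀ hr.le hx₁p 2
    have h3 : ‖x₁ - y‖ ^ 2 ≤ (r - s) ^ 2 := pow_le_pow_left₀ (norm_nonneg _) hx₁y 2
    have h4 : ‖s • (x₁ - y) - (r - s) • (y - p)‖ ^ 2 ≤ 0 := by
      rw [norm_sub_sq_real, norm_smul, norm_smul, real_inner_smul_left, real_inner_smul_right,
        Real.norm_of_nonneg hs0.le, Real.norm_of_nonneg hρ.le, mul_pow, mul_pow, ← hs]
      have h5 : 2 * s * (r - s) ≤ 2 * inner ℝ (x₁ - y) (y - p) := by nlinarith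
      have h6 := mul_le_mul_of_nonneg_left h5 (mul_nonneg hs0.le hρ.le)
      have h7 := mul_le_mul_of_nonneg_left h3 (sq_nonneg s)
      nlinarith
    exact sub_eq_zero.1 (norm_eq_zero.1 (pow_eq_zero_iff two_ne_zero |>.1
      (le_antisymm h4 (sq_nonneg _))))
  have hx₁p' : s • (x₁ - p) = r • (y - p) := by
    rw [← sub_add_sub_cancel x₁ y p, smul_add, hcol, ← add_smul, sub_add_cancel]
  have h1 : s * r ≤ ‖r • (y - p) - s • (q - p)‖ := by
    rw [← hx₁p', ← smul_sub, sub_sub_sub_cancel_right, norm_smul, Real.norm_of_nonneg hs0.le]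
    exact mul_le_mul_of_nonneg_left hx₁q hs0.le
  have h2 := pow_le_pow_left₀ (by positivity) h1 2
  rw [norm_sub_sq_real, norm_smul, norm_smul, real_inner_smul_left, real_inner_smul_right,
    Real.norm_of_nonneg hs0.le, Real.norm_of_nonneg hr.le, ← hs] at h2
  have h3 : s * (2 * (r * inner ℝ (y - p) (q - p))) ≤ s * (s * ‖q - p‖ ^ 2) := by nlinarith
  have := le_of_mul_le_mul_left h3 hs0
  linarith

end Reach

/-! ### Federer's chord bound from the reach -/

section Federer

variable {d n : ℕ} {M : Set (EuclideanSpace ℝ (Fin n))} {p : EuclideanSpace ℝ (Fin n)} {τ : ℝ}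

theorem exists_unique_nearest_of_lt_reach {r : ℝ}
    (h : ENNReal.ofReal r < reach M) (hne : M.Nonempty) (x : EuclideanSpace ℝ (Fin n))
    (hx : infDist x M ≤ r) : ∃! q, q ∈ M ∧ ∀ q' ∈ M, dist x q ≤ dist x q' := by
  simp only [reach, lt_iSup_iff] at h
  obtain ⟨r₀, h₀, hr₀⟩ := h
  refine h₀ x ?_
  rw [← ENNReal.ofReal_toReal (infEDist_ne_top hne)]
  exact (ENNReal.ofReal_le_ofReal hx).trans hr₀.le

theorem inner_le_of_reach (hM : IsClosed M) (hC : IsC2Submanifold d M) (hτ : 0 < τ)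
    (hreach : ENNReal.ofReal τ ≤ reach M) (hp : p ∈ M) {a : EuclideanSpace ℝ (Fin n)}
    (ha : a ∈ (tangentSpace M p)ᗮ) {q : EuclideanSpace ℝ (Fin n)} (hq : q ∈ M) :
    inner ℝ a (q - p) ≤ ‖a‖ * ‖q - p‖ ^ 2 / (2 * τ) := by
  obtain ⟨C, hC0, hev⟩ := hC.exists_norm_normalProj_le hp
  obtain ⟨δ, hδ, hball⟩ := Metric.mem_nhdsWithin_iff.1 hev
  have hproj : ∀ w, inner ℝ a w = inner ℝ a (normalProj M p w) := fun w => by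
    rw [normalProj, ← Submodule.inner_starProjection_left_eq_right,
      Submodule.starProjection_eq_self_iff.2 ha]
  -- For such `t` the point `p` is nearest to `p + t • a`: second-order contact handles points of
  -- `M` within `δ` of `p`, and Cauchy–Schwarz handles the others.
  obtain ⟨t, ht, htC, htδ⟩ : ∃ t > 0, 2 * t * ‖a‖ * C ≤ 1 ∧ 2 * t * ‖a‖ ≤ δ := by
    refine ⟨(2 * (‖a‖ + 1) * (C + δ⁻¹))⁻¹, by positivity, ?_, ?_⟩
    · have h1 : 2 * ‖a‖ * C ≤ 2 * (‖a‖ + 1) * (C + δ⁻¹) := by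
        gcongr <;> linarith [inv_pos.2 hδ]
      have := mul_le_mul_of_nonneg_left h1
        (inv_nonneg.2 (by positivity : 0 ≤ 2 * (‖a‖ + 1) * (C + δ⁻¹)))
      rw [inv_mul_cancel₀ (by positivity)] at this
      linarith
    · have h1 : 2 * ‖a‖ * δ⁻¹ ≤ 2 * (‖a‖ + 1) * (C + δ⁻¹) := by
        gcongr <;> linarith
      have := mul_le_mul_of_nonneg_left h1
        (inv_nonneg.2 (by positivity : 0 ≤ 2 * (‖a‖ + 1) * (C + δ⁻¹)))
      rw [inv_mul_cancel₀ (by positivity)] at this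
      have := mul_le_mul_of_nonneg_right this hδ.le
      rw [one_mul] at this
      refine le_trans (le_of_eq ?_) this
      field_simp
  have hnear : infDist (p + t • a) M = dist (p + t • a) p := by
    refine le_antisymm (infDist_le_dist_of_mem hp) ((le_infDist ⟨p, hp⟩).2 fun {z} hz => ?_)
    rw [dist_eq_norm, dist_eq_norm, add_sub_cancel_left,
      show p + t • a - z = t • a - (z - p) by abel]
    refine le_of_sq_le_sq ?_ (norm_nonneg _)
    rw [norm_sub_sq_real, real_inner_smul_left]
    have hi : 2 * (t * inner ℝ a (z - p)) ≤ ‖z - p‖ ^ 2 := by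
      rcases lt_or_ge (dist z p) δ with hzδ | hzδ
      · have h1 : ‖normalProj M p (z - p)‖ ≤ C * ‖z - p‖ ^ 2 := hball ⟨hzδ, hz⟩
        have h2 : inner ℝ a (z - p) ≤ ‖a‖ * (C * ‖z - p‖ ^ 2) := by
          rw [hproj]
          exact (real_inner_le_norm _ _).trans (mul_le_mul_of_nonneg_left h1 (norm_nonneg _))
        have h3 := mul_le_mul_of_nonneg_left h2 ht.le
        nlinarith [sq_nonneg ‖z - p‖, mul_le_mul_of_nonneg_right htC (sq_nonneg ‖z - p‖)]
      · rw [dist_eq_norm] at hzδ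
        have h2 := mul_le_mul_of_nonneg_left (real_inner_le_norm a (z - p)) ht.le
        nlinarith [norm_nonneg (z - p), mul_le_mul_of_nonneg_right htδ (norm_nonneg (z - p)),
          mul_le_mul_of_nonneg_right hzδ (norm_nonneg (z - p))]
    linarith
  -- The supremum defining the reach may not be attained, so the bound is proved for `r < τ` and
  -- then passed to the limit.
  have hr : ∀ r ∈ Ioo 0 τ, inner ℝ a (q - p) ≤ ‖a‖ * ‖q - p‖ ^ 2 / (2 * r) := by
    rintro r ⟨hr0, hrτ⟩
    have hlt : ENNReal.ofReal r < reach M :=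
      ((ENNReal.ofReal_lt_ofReal_iff hτ).2 hrτ).trans_le hreach
    have h1 := inner_le_of_unique_nearest hM hr0
      (exists_unique_nearest_of_lt_reach hlt ⟨p, hp⟩) hp hnear hq
    rw [add_sub_cancel_left, real_inner_smul_left, norm_smul, Real.norm_of_nonneg ht.le,
      mul_assoc, mul_div_assoc] at h1
    exact le_of_mul_le_mul_left h1 ht
  have hlim : Tendsto (fun r : ℝ => ‖a‖ * ‖q - p‖ ^ 2 / (2 * r)) (𝓝[<] τ)
      (𝓝 (‖a‖ * ‖q - p‖ ^ 2 / (2 * τ))) := by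
    have : ContinuousAt (fun r : ℝ => ‖a‖ * ‖q - p‖ ^ 2 / (2 * r)) τ := by
      fun_prop (disch := positivity)
    exact this.tendsto.mono_left nhdsWithin_le_nhds
  refine ge_of_tendsto hlim ?_
  filter_upwards [Ioo_mem_nhdsLT hτ] with r hr' using hr r hr'

/-- Federer's bound on the distance of a chord from the tangent space, as a property of `M`. -/
def HasTangentBound (τ : ℝ) (M : Set (EuclideanSpace ℝ (Fin n))) : Prop :=
  ∀ p ∈ M, ∀ q ∈ M, ‖normalProj M p (q - p)‖ ≤ ‖q - p‖ ^ 2 / (2 * τ)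

/-- Test the touching-ball inequality on the normal part of the chord itself. -/
theorem hasTangentBound_of_reach (hM : IsClosed M) (hC : IsC2Submanifold d M) (hτ : 0 < τ)
    (hreach : ENNReal.ofReal τ ≤ reach M) : HasTangentBound τ M := by
  intro p hp q hq
  have h := inner_le_of_reach hM hC hτ hreach hp (a := normalProj M p (q - p))
    (Submodule.starProjection_apply_mem _ _) hq
  have h1 : inner ℝ (normalProj M p (q - p)) (q - p) = ‖normalProj M p (q - p)‖ ^ 2 := by
    have h2 := Submodule.starProjection_inner_eq_zero (K := (tangentSpace M p)ᗮ) (q - p)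
      (normalProj M p (q - p)) (Submodule.starProjection_apply_mem _ _)
    change inner ℝ (q - p - normalProj M p (q - p)) (normalProj M p (q - p)) = 0 at h2
    rw [inner_sub_left, sub_eq_zero, real_inner_self_eq_norm_sq] at h2
    rw [real_inner_comm, h2]
  rw [h1] at h
  rcases (norm_nonneg (normalProj M p (q - p))).eq_or_lt with h0 | h0
  · rw [← h0]; positivity
  · rw [sq, mul_div_assoc] at h
    exact le_of_mul_le_mul_left h h0

/-- A linear functional that is maximal on `M` at `p` up to second order is normal at `p`. -/
theorem IsC2Submanifold.mem_normal_of_inner_le (hC : IsC2Submanifold d M) (hp : p ∈ M)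
    {a : EuclideanSpace ℝ (Fin n)} {K : ℝ}
    (h : ∀ q ∈ M, inner ℝ a (q - p) ≤ K * ‖q - p‖ ^ 2) : a ∈ (tangentSpace M p)ᗮ := by
  rw [Submodule.mem_orthogonal']
  intro v hv
  obtain ⟨γ, hγ0, hγ, hγM⟩ := hC.exists_curve hp hv
  have h1 : HasDerivAt (fun t => γ t - p) v 0 := hγ.sub_const p
  have h2 : HasDerivAt (fun t => inner ℝ a (γ t - p) - K * inner ℝ (γ t - p) (γ t - p))
      (inner ℝ a v) 0 := by
    have h3 := ((hasDerivAt_const (0 : ℝ) a).inner ℝ h1).sub ((h1.inner ℝ h1).const_mul K)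
    exact h3.congr_deriv (by simp [hγ0])
  refine IsLocalMax.hasDerivAt_eq_zero (f := fun t =>
    inner ℝ a (γ t - p) - K * inner ℝ (γ t - p) (γ t - p)) ?_ h2
  filter_upwards [hγM] with t ht
  have := h _ ht
  simp only [hγ0, sub_self, inner_zero_right, mul_zero, real_inner_self_eq_norm_sq]
  linarith

theorem IsC2Submanifold.sub_mem_normal_of_nearest (hC : IsC2Submanifold d M)
    {y ξ : EuclideanSpace ℝ (Fin n)} (hξ : ξ ∈ M) (hy : infDist y M = dist y ξ) :
    y - ξ ∈ (tangentSpace M ξ)ᗮ :=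
  hC.mem_normal_of_inner_le hξ (K := 1 / 2) fun q hq => by
    have := norm_sub_sq_le_of_infDist_eq hy hq
    linarith

end Federer

/-! ### Tangent and normal projections -/

section Projections

variable {n : ℕ} {M : Set (EuclideanSpace ℝ (Fin n))} (p v : EuclideanSpace ℝ (Fin n))

theorem tangentProj_add_normalProj : tangentProj M p v + normalProj M p v = v :=
  Submodule.starProjection_add_starProjection_orthogonal v

theorem normalProj_apply : normalProj M p v = v - tangentProj M p v :=
  eq_sub_of_add_eq' (tangentProj_add_normalProj p v)

theorem norm_tangentProj_le : ‖tangentProj M p v‖ ≤ ‖v‖ :=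
  Submodule.norm_starProjection_apply_le _ v

theorem norm_normalProj_le : ‖normalProj M p v‖ ≤ ‖v‖ :=
  Submodule.norm_starProjection_apply_le _ v

theorem tangentProj_mem : tangentProj M p v ∈ tangentSpace M p :=
  Submodule.starProjection_apply_mem _ v

variable {p v}

theorem tangentProj_eq_self (hv : v ∈ tangentSpace M p) : tangentProj M p v = v :=
  Submodule.starProjection_eq_self_iff.2 hv

theorem tangentProj_eq_zero (hv : v ∈ (tangentSpace M p)ᗮ) : tangentProj M p v = 0 :=
  (Submodule.starProjection_apply_eq_zero_iff _).2 hv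

theorem normalProj_eq_zero (hv : v ∈ tangentSpace M p) : normalProj M p v = 0 := by
  rw [normalProj_apply, tangentProj_eq_self hv, sub_self]

theorem normalProj_tangentProj (q : EuclideanSpace ℝ (Fin n)) :
    normalProj M p (tangentProj M p q) = 0 :=
  normalProj_eq_zero (tangentProj_mem p q)

theorem tangentProj_tangentProj (q : EuclideanSpace ℝ (Fin n)) :
    tangentProj M p (tangentProj M p q) = tangentProj M p q :=
  tangentProj_eq_self (tangentProj_mem p q)

end Projections

/-! ### First-order estimates: tangent spaces vary at rate `14 / τ` -/

section FirstOrder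

variable {d n : ℕ} {M : Set (EuclideanSpace ℝ (Fin n))} {p q : EuclideanSpace ℝ (Fin n)} {τ : ℝ}

/-- The distance to `M` grows at most at the speed of the normal component of the motion. -/
theorem eventually_infDist_le (hC : IsC2Submanifold d M) {y ξ : EuclideanSpace ℝ (Fin n)}
    (hξ : ξ ∈ M) (hy : infDist y M = dist y ξ) {v : EuclideanSpace ℝ (Fin n)} {r : ℝ}
    (hr : ‖normalProj M ξ v‖ < r) :
    ∀ᶠ t in 𝓝[>] (0 : ℝ), infDist (y + t • v) M ≤ infDist y M + r * t := by
  obtain ⟨γ, hγ0, hγ, hγM⟩ := hC.exists_curve hξ (tangentProj_mem (M := M) ξ v)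
  have h1 := (hasDerivAt_iff_isLittleO.1 hγ).def (sub_pos.2 hr)
  filter_upwards [nhdsWithin_le_nhds h1, nhdsWithin_le_nhds hγM, self_mem_nhdsWithin]
    with t ht htM ht0
  have ht0' : (0 : ℝ) < t := ht0
  rw [sub_zero, hγ0, Real.norm_of_nonneg ht0'.le] at ht
  have hdec : y + t • v - γ t =
      (y - ξ) + t • normalProj M ξ v - (γ t - ξ - t • tangentProj M ξ v) := by
    rw [normalProj_apply, smul_sub]; abel
  calc infDist (y + t • v) M ≤ dist (y + t • v) (γ t) := infDist_le_dist_of_mem htM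
    _ = ‖(y - ξ) + t • normalProj M ξ v - (γ t - ξ - t • tangentProj M ξ v)‖ := by
        rw [dist_eq_norm, hdec]
    _ ≤ ‖y - ξ‖ + ‖t • normalProj M ξ v‖ + ‖γ t - ξ - t • tangentProj M ξ v‖ :=
        (norm_sub_le _ _).trans (add_le_add_left (norm_add_le _ _) _)
    _ ≤ infDist y M + r * t := by
        rw [norm_smul, Real.norm_of_nonneg ht0'.le, hy, dist_eq_norm]
        linarith

/-- Points near the tangent space at `p` are near `M`, with a quadratic error. -/
theorem infDist_add_le (hM : IsClosed M) (hC : IsC2Submanifold d M) (hτ : 0 < τ)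
    (hF : HasTangentBound τ M) (hp : p ∈ M) (v : EuclideanSpace ℝ (Fin n)) :
    infDist (p + v) M ≤ ‖normalProj M p v‖ + 2 * ‖v‖ ^ 2 / τ := by
  have hex : ∀ t : ℝ, ∃ ξ ∈ M, infDist (p + t • v) M = dist (p + t • v) ξ := fun t =>
    hM.exists_infDist_eq_dist ⟨p, hp⟩ _
  choose ξ hξ hξd using hex
  have key : ∀ η > ‖normalProj M p v‖, ∀ k > 2 * ‖v‖ ^ 2 / τ, infDist (p + v) M ≤ η + k := by
    intro η hη k hk
    have h := image_le_of_liminf_slope_right_lt_deriv_boundary'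
      (f := fun t : ℝ => infDist (p + t • v) M) (f' := fun t => ‖normalProj M (ξ t) v‖)
      (B := fun t => η * t + k * t ^ 2) (B' := fun t => η + 2 * k * t) (a := 0) (b := 1)
      ?_ ?_ ?_ ?_ ?_ ?_ (right_mem_Icc.2 zero_le_one)
    · simpa using h
    · fun_prop
    · intro x _ r hr
      obtain ⟨r', hr', hr'r⟩ := exists_between hr
      have h1 := eventually_infDist_le hC (hξ x) (hξd x) hr'
      have h2 : Tendsto (fun z : ℝ => z - x) (𝓝[>] x) (𝓝[>] 0) := by
        refine tendsto_nhdsWithin_iff.2 ⟨?_, ?_⟩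
        · exact (Continuous.tendsto' (f := fun z : ℝ => z - x) (by fun_prop) x 0
            (sub_self x)).mono_left nhdsWithin_le_nhds
        · filter_upwards [self_mem_nhdsWithin] with z hz using sub_pos.2 (mem_Ioi.1 hz)
      refine Eventually.frequently ?_
      filter_upwards [h2.eventually h1, self_mem_nhdsWithin] with z hz hzx
      have hzx' : 0 < z - x := sub_pos.2 (mem_Ioi.1 hzx)
      rw [slope_def_field, div_lt_iff₀ hzx']
      rw [add_assoc, ← add_smul, add_sub_cancel] at hz
      nlinarith
    · simp [infDist_zero_of_mem hp]
    · fun_prop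
    · intro x _
      have h1 := ((hasDerivAt_id x).const_mul η).add ((hasDerivAt_pow 2 x).const_mul k)
      exact (h1.congr_deriv (by simp; ring)).hasDerivWithinAt
    -- The comparison theorem needs a strict slope inequality only where the distance equals `η x +
    -- k x²`. There this equality bounds the normal part of `p + x • v - ξ x`, and the chord bound
    -- controls that of `p - ξ x`; their difference is `x` times the normal part of `v`.
    · rintro x ⟨hx0, hx1⟩ hfx
      change infDist (p + x • v) M = η * x + k * x ^ 2 at hfx
      rcases hx0.eq_or_lt with rfl | hx0
      · have h0 : ξ 0 = p := by
          have := hξd 0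
          rw [zero_smul, add_zero, infDist_zero_of_mem hp] at this
          exact (dist_eq_zero.1 this.symm).symm
        simpa [h0] using hη
      have he : ‖p + x • v - ξ x‖ = η * x + k * x ^ 2 := by
        rw [← dist_eq_norm, ← hξd, hfx]
      have hle : ‖p + x • v - ξ x‖ ≤ x * ‖v‖ := by
        rw [← dist_eq_norm, ← hξd]
        refine (infDist_le_dist_of_mem hp).trans (le_of_eq ?_)
        rw [dist_eq_norm, add_sub_cancel_left, norm_smul, Real.norm_of_nonneg hx0.le]
      have hpξ : ‖p - ξ x‖ ≤ 2 * (x * ‖v‖) := by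
        have h1 : p - ξ x = (p + x • v - ξ x) - x • v := by abel
        rw [h1]
        refine (norm_sub_le _ _).trans ?_
        rw [norm_smul, Real.norm_of_nonneg hx0.le]
        linarith
      have h1 : x • normalProj M (ξ x) v =
          normalProj M (ξ x) (p + x • v - ξ x) - normalProj M (ξ x) (p - ξ x) := by
        rw [← map_sub, ← map_smul]; congr 1; abel
      have h2 : x * ‖normalProj M (ξ x) v‖ ≤ η * x + k * x ^ 2 + ‖p - ξ x‖ ^ 2 / (2 * τ) := by
        rw [show x * ‖normalProj M (ξ x) v‖ = ‖x • normalProj M (ξ x) v‖ by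
          rw [norm_smul, Real.norm_of_nonneg hx0.le], h1, ← he]
        exact (norm_sub_le _ _).trans
          (add_le_add (norm_normalProj_le _ _) (hF _ (hξ x) p hp))
      have h3 : ‖p - ξ x‖ ^ 2 / (2 * τ) ≤ 2 * ‖v‖ ^ 2 / τ * x ^ 2 := by
        rw [div_le_iff₀ (by positivity)]
        have := pow_le_pow_left₀ (norm_nonneg _) hpξ 2
        have h4 : 2 * ‖v‖ ^ 2 / τ * x ^ 2 * (2 * τ) = (2 * (x * ‖v‖)) ^ 2 := by
          field_simp
        rw [h4]; exact this
      have h5 : 2 * ‖v‖ ^ 2 / τ * x ^ 2 < k * x ^ 2 := mul_lt_mul_of_pos_right hk (by positivity)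
      refine lt_of_mul_lt_mul_left ?_ hx0.le
      nlinarith
  refine le_of_forall_pos_le_add fun ε hε => ?_
  have := key (‖normalProj M p v‖ + ε / 2) (by linarith) (2 * ‖v‖ ^ 2 / τ + ε / 2) (by linarith)
  linarith

/-- Rescale `w` to length `h = ‖p - q‖`. A point `x` of `M` then lies within `2h² / τ` of `p + c •
w`, and the chord bound at `q` applies to both `x` and `p`; the constant is `2 + 9/2 + 1/2 = 7`. -/
theorem norm_normalProj_of_tangent_le (hM : IsClosed M) (hC : IsC2Submanifold d M) (hτ : 0 < τ)
    (hF : HasTangentBound τ M) (hp : p ∈ M) (hq : q ∈ M) {w : EuclideanSpace ℝ (Fin n)}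
    (hw : w ∈ tangentSpace M p) : ‖normalProj M q w‖ ≤ 7 * ‖p - q‖ / τ * ‖w‖ := by
  rcases (norm_nonneg w).eq_or_lt with h0 | hw0
  · rw [norm_eq_zero.1 h0.symm]; simp
  rcases (norm_nonneg (p - q)).eq_or_lt with h0 | hh
  · obtain rfl := sub_eq_zero.1 (norm_eq_zero.1 h0.symm)
    rw [normalProj_eq_zero hw]; simp
  set h := ‖p - q‖ with hdef
  set c := h / ‖w‖ with hc
  have hc0 : 0 < c := by positivity
  have hcw : ‖c • w‖ = h := by
    rw [norm_smul, Real.norm_of_nonneg hc0.le, hc]; field_simp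
  obtain ⟨x, hx, hxd⟩ := hM.exists_infDist_eq_dist ⟨p, hp⟩ (p + c • w)
  have h1 : ‖p + c • w - x‖ ≤ 2 * h ^ 2 / τ := by
    rw [← dist_eq_norm, ← hxd]
    refine (infDist_add_le hM hC hτ hF hp _).trans (le_of_eq ?_)
    rw [normalProj_eq_zero (Submodule.smul_mem _ _ hw), norm_zero, zero_add, hcw]
  have h2 : ‖p + c • w - x‖ ≤ h := by
    rw [← dist_eq_norm, ← hxd]
    refine (infDist_le_dist_of_mem hp).trans (le_of_eq ?_)
    rw [dist_eq_norm, add_sub_cancel_left, hcw]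
  have hxq : ‖x - q‖ ≤ 3 * h := by
    have : x - q = (p - q) + c • w - (p + c • w - x) := by abel
    rw [this]
    refine (norm_sub_le _ _).trans ?_
    have := norm_add_le (p - q) (c • w)
    rw [hcw] at this
    linarith
  have hdec : c • normalProj M q w =
      normalProj M q (p + c • w - x) + normalProj M q (x - q) - normalProj M q (p - q) := by
    rw [← map_add, ← map_sub, ← map_smul]; congr 1; abel
  have h3 : ‖normalProj M q (x - q)‖ ≤ (3 * h) ^ 2 / (2 * τ) :=
    (hF q hq x hx).trans (by gcongr)
  have h4 : ‖normalProj M q (p - q)‖ ≤ h ^ 2 / (2 * τ) := hF q hq p hp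
  have h5 : c * ‖normalProj M q w‖ ≤ 2 * h ^ 2 / τ + (3 * h) ^ 2 / (2 * τ) + h ^ 2 / (2 * τ) := by
    rw [show c * ‖normalProj M q w‖ = ‖c • normalProj M q w‖ by
      rw [norm_smul, Real.norm_of_nonneg hc0.le], hdec]
    refine (norm_sub_le _ _).trans (add_le_add ((norm_add_le _ _).trans (add_le_add ?_ h3)) h4)
    exact (norm_normalProj_le _ _).trans h1
  refine le_of_mul_le_mul_left (h5.trans (le_of_eq ?_)) hc0
  rw [hc]
  field_simp
  ring

/-- The tangent projection is Lipschitz. -/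
theorem norm_tangentProj_sub_le (hM : IsClosed M) (hC : IsC2Submanifold d M) (hτ : 0 < τ)
    (hF : HasTangentBound τ M) (hp : p ∈ M) (hq : q ∈ M) :
    ‖tangentProj M p - tangentProj M q‖ ≤ 14 / τ * ‖p - q‖ := by
  refine ContinuousLinearMap.opNorm_le_bound _ (by positivity) fun w => ?_
  have hdec : (tangentProj M p - tangentProj M q) w =
      normalProj M q (tangentProj M p w) - tangentProj M q (normalProj M p w) := by
    rw [normalProj_apply, normalProj_apply, map_sub, sub_apply]; abel
  have h1 : ‖normalProj M q (tangentProj M p w)‖ ≤ 7 * ‖p - q‖ / τ * ‖w‖ :=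
    (norm_normalProj_of_tangent_le hM hC hτ hF hp hq (tangentProj_mem p w)).trans
      (mul_le_mul_of_nonneg_left (norm_tangentProj_le _ _) (by positivity))
  -- This operator is the adjoint of `normalProj M p ∘ tangentProj M q`, which is bounded by
  -- exchanging `p` and `q`.
  have h2 : ‖tangentProj M q (normalProj M p w)‖ ≤ 7 * ‖p - q‖ / τ * ‖w‖ := by
    set u := tangentProj M q (normalProj M p w) with hu
    rcases (norm_nonneg u).eq_or_lt with h0 | h0
    · rw [← h0]; positivity
    have hself : ‖u‖ ^ 2 = inner ℝ (normalProj M p u) w := by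
      rw [← real_inner_self_eq_norm_sq]
      nth_rewrite 2 [hu]
      rw [tangentProj, ← Submodule.inner_starProjection_left_eq_right]
      change inner ℝ (tangentProj M q u) _ = _
      rw [tangentProj_eq_self (tangentProj_mem q _)]
      exact (Submodule.inner_starProjection_left_eq_right _ u w).symm
    have h3 : ‖normalProj M p u‖ ≤ 7 * ‖p - q‖ / τ * ‖u‖ := by
      rw [norm_sub_rev]
      exact norm_normalProj_of_tangent_le hM hC hτ hF hq hp (tangentProj_mem q _)
    have h4 : ‖u‖ * ‖u‖ ≤ ‖u‖ * (7 * ‖p - q‖ / τ * ‖w‖) := by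
      rw [← sq, hself]
      refine (real_inner_le_norm _ _).trans ?_
      nlinarith [mul_le_mul_of_nonneg_right h3 (norm_nonneg w)]
    exact le_of_mul_le_mul_left h4 h0
  rw [hdec]
  refine (norm_sub_le _ _).trans ((add_le_add h1 h2).trans (le_of_eq ?_))
  ring

/-- The derivative of the tangent projection is bounded on tangent vectors. -/
theorem norm_fderivWithin_tangentProj_le (hM : IsClosed M) (hC : IsC2Submanifold d M)
    (hτ : 0 < τ) (hF : HasTangentBound τ M) (hp : p ∈ M) {v : EuclideanSpace ℝ (Fin n)}
    (hv : v ∈ tangentSpace M p) :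
    ‖fderivWithin ℝ (tangentProj M) M p v‖ ≤ 14 / τ * ‖v‖ := by
  obtain ⟨γ, hγ0, hγ, hγM⟩ := hC.exists_curve hp hv
  have hD : HasFDerivWithinAt (tangentProj M) (fderivWithin ℝ (tangentProj M) M p) M (γ 0) := by
    rw [hγ0]; exact (hC.differentiableWithinAt_tangentProj hp).hasFDerivWithinAt
  have h1 : HasDerivAt (tangentProj M ∘ γ) (fderivWithin ℝ (tangentProj M) M p v) 0 :=
    (hD.comp_hasDerivWithinAt (s := γ ⁻¹' M) 0 hγ.hasDerivWithinAt
      (fun _ h => h)).hasDerivAt hγM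
  have h2 := (hasDerivAt_iff_tendsto_slope.1 h1).norm
  have h3 := ((hasDerivAt_iff_tendsto_slope.1 hγ).norm).const_mul (14 / τ)
  refine le_of_tendsto_of_tendsto h2 h3 ?_
  filter_upwards [nhdsWithin_le_nhds hγM] with t ht
  rw [slope_def_module, slope_def_module, norm_smul, norm_smul, ← mul_assoc, mul_comm (14 / τ),
    mul_assoc]
  refine mul_le_mul_of_nonneg_left ?_ (norm_nonneg _)
  exact norm_tangentProj_sub_le hM hC hτ hF ht (hγ0 ▸ hp)

end FirstOrder

/-- A mean value inequality with an upper bound for the right difference quotients. -/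
theorem norm_image_sub_le_of_eventually {F : Type*} [NormedAddCommGroup F] {f : ℝ → F} {K : ℝ}
    (hf : ContinuousOn f (Icc 0 1))
    (h : ∀ t ∈ Ico (0 : ℝ) 1, ∀ r > K, ∀ᶠ s in 𝓝[>] t, ‖f s - f t‖ ≤ r * (s - t)) :
    ∀ ⦃t⦄, t ∈ Icc (0 : ℝ) 1 → ‖f t - f 0‖ ≤ K * t := by
  refine image_le_of_liminf_slope_right_le_deriv_boundary (f := fun t => ‖f t - f 0‖)
    (B := fun t => K * t) (B' := fun _ => K) (hf.sub continuousOn_const).norm (by simp)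
    (by fun_prop) (fun x _ => ?_) fun t ht r hr => ?_
  · simpa using ((hasDerivAt_id x).const_mul K).hasDerivWithinAt
  · obtain ⟨r', hr', hr'r⟩ := exists_between hr
    refine Eventually.frequently ?_
    filter_upwards [h t ht r' hr', self_mem_nhdsWithin] with s hs hst
    have hst' : 0 < s - t := sub_pos.2 (mem_Ioi.1 hst)
    rw [slope_def_field, div_lt_iff₀ hst']
    have h1 : ‖f s - f 0‖ - ‖f t - f 0‖ ≤ ‖f s - f t‖ := by
      have := norm_sub_norm_le (f s - f 0) (f t - f 0)
      rwa [sub_sub_sub_cancel_right] at this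
    nlinarith

/-! ### Second-order Taylor expansion along nearest points -/

section SecondOrder

variable {d n : ℕ} {M : Set (EuclideanSpace ℝ (Fin n))} {p v : EuclideanSpace ℝ (Fin n)}
  {τ Λ : ℝ} {ξ : ℝ → EuclideanSpace ℝ (Fin n)}

theorem inner_le_of_mem_normal (hF : HasTangentBound τ M) (hp : p ∈ M)
    {a q : EuclideanSpace ℝ (Fin n)} (ha : a ∈ (tangentSpace M p)ᗮ) (hq : q ∈ M) :
    inner ℝ a (q - p) ≤ ‖a‖ * (‖q - p‖ ^ 2 / (2 * τ)) := by
  have h : inner ℝ a (q - p) = inner ℝ a (normalProj M p (q - p)) := by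
    rw [normalProj, ← Submodule.inner_starProjection_left_eq_right,
      Submodule.starProjection_eq_self_iff.2 ha]
  rw [h]
  exact (real_inner_le_norm _ _).trans (mul_le_mul_of_nonneg_left (hF p hp q hq) (norm_nonneg _))

/-- Nearest points depend in a Lipschitz way on the point, within half the reach. -/
theorem norm_nearest_sub_le (hC : IsC2Submanifold d M) (hτ : 0 < τ) (hF : HasTangentBound τ M)
    {y y' x x' : EuclideanSpace ℝ (Fin n)} (hx : x ∈ M) (hx' : x' ∈ M)
    (hy : infDist y M = dist y x) (hy' : infDist y' M = dist y' x')
    (hyτ : ‖y - x‖ ≤ τ / 2) (hyτ' : ‖y' - x'‖ ≤ τ / 2) : ‖x' - x‖ ≤ 2 * ‖y' - y‖ := by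
  have h1 := inner_le_of_mem_normal hF hx (hC.sub_mem_normal_of_nearest hx hy) hx'
  have h2 := inner_le_of_mem_normal hF hx' (hC.sub_mem_normal_of_nearest hx' hy') hx
  have h3 : inner ℝ (y' - y) (x' - x) =
      ‖x' - x‖ ^ 2 - inner ℝ (y - x) (x' - x) - inner ℝ (y' - x') (x - x') := by
    have : y' - y = (x' - x) - (y - x) + (y' - x') := by abel
    rw [this, inner_add_left, inner_sub_left, real_inner_self_eq_norm_sq, ← neg_sub x' x,
      inner_neg_right]
    ring
  have h4 := real_inner_le_norm (y' - y) (x' - x)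
  have h5 : ∀ b : ℝ, b ≤ τ / 2 → b * (‖x' - x‖ ^ 2 / (2 * τ)) ≤ ‖x' - x‖ ^ 2 / 4 := by
    intro b hb
    refine (mul_le_mul_of_nonneg_right hb (by positivity)).trans (le_of_eq ?_)
    field_simp
    ring
  rw [norm_sub_rev x x'] at h2
  have h6 := h1.trans (h5 _ hyτ)
  have h7 := h2.trans (h5 _ hyτ')
  have h8 : ‖x' - x‖ * ‖x' - x‖ ≤ ‖x' - x‖ * (2 * ‖y' - y‖) := by nlinarith
  rcases (norm_nonneg (x' - x)).eq_or_lt with h0 | h0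
  · rw [← h0]; positivity
  · exact le_of_mul_le_mul_left h8 h0

/-- `ξ t` is a nearest point of `M` to `p + t v`. -/
structure IsNearestPath (M : Set (EuclideanSpace ℝ (Fin n))) (p v : EuclideanSpace ℝ (Fin n))
    (ξ : ℝ → EuclideanSpace ℝ (Fin n)) : Prop where
  mem : ∀ t, ξ t ∈ M
  infDist_eq : ∀ t, infDist (p + t • v) M = dist (p + t • v) (ξ t)

namespace IsNearestPath

theorem zero (hξ : IsNearestPath M p v ξ) (hp : p ∈ M) : ξ 0 = p := by
  have := hξ.infDist_eq 0
  rw [zero_smul, add_zero, infDist_zero_of_mem hp] at this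
  exact (dist_eq_zero.1 this.symm).symm

theorem norm_sub_le_norm (hξ : IsNearestPath M p v ξ) (hp : p ∈ M) {t : ℝ} (ht : t ∈ Icc (0 : ℝ) 1) :
    ‖p + t • v - ξ t‖ ≤ ‖v‖ := by
  rw [← dist_eq_norm, ← hξ.infDist_eq]
  refine (infDist_le_dist_of_mem hp).trans ?_
  rw [dist_eq_norm, add_sub_cancel_left, norm_smul, Real.norm_of_nonneg ht.1]
  exact mul_le_of_le_one_left (norm_nonneg _) ht.2

/-- The condition `hv` holds both for tangent `v` and for chords `v = x - p` of `M`; the expansion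
is needed in both cases. -/
theorem norm_sub_le_sq (hξ : IsNearestPath M p v ξ) (hM : IsClosed M) (hC : IsC2Submanifold d M)
    (hτ : 0 < τ) (hF : HasTangentBound τ M) (hp : p ∈ M)
    (hv : ‖normalProj M p v‖ ≤ ‖v‖ ^ 2 / (2 * τ)) {t : ℝ} (ht : t ∈ Icc (0 : ℝ) 1) :
    ‖p + t • v - ξ t‖ ≤ 3 * ‖v‖ ^ 2 / τ := by
  rw [← dist_eq_norm, ← hξ.infDist_eq]
  refine (infDist_add_le hM hC hτ hF hp _).trans ?_
  rw [map_smul, norm_smul, norm_smul, Real.norm_of_nonneg ht.1, mul_pow]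
  have h1 : t * ‖normalProj M p v‖ ≤ ‖v‖ ^ 2 / (2 * τ) :=
    (mul_le_of_le_one_left (norm_nonneg _) ht.2).trans hv
  have h2 : 2 * (t ^ 2 * ‖v‖ ^ 2) / τ ≤ 2 * (1 * ‖v‖ ^ 2) / τ := by
    gcongr
    exact pow_le_one₀ ht.1 ht.2
  have h3 : ‖v‖ ^ 2 / (2 * τ) + 2 * (1 * ‖v‖ ^ 2) / τ ≤ 3 * ‖v‖ ^ 2 / τ := by
    rw [div_add_div _ _ (by positivity) hτ.ne', div_le_div_iff₀ (by positivity) hτ]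
    have : 0 ≤ ‖v‖ ^ 2 * τ ^ 2 := by positivity
    nlinarith
  linarith

theorem norm_sub_le (hξ : IsNearestPath M p v ξ) (hC : IsC2Submanifold d M)
    (hτ : 0 < τ) (hF : HasTangentBound τ M) (hp : p ∈ M) (hvτ : ‖v‖ ≤ τ / 2)
    {t s : ℝ} (ht : t ∈ Icc (0 : ℝ) 1) (hs : s ∈ Icc (0 : ℝ) 1) :
    ‖ξ s - ξ t‖ ≤ 2 * (|s - t| * ‖v‖) := by
  refine (norm_nearest_sub_le hC hτ hF (hξ.mem t) (hξ.mem s) (hξ.infDist_eq t) (hξ.infDist_eq s)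
    ((hξ.norm_sub_le_norm hp ht).trans hvτ) ((hξ.norm_sub_le_norm hp hs).trans hvτ)).trans ?_
  rw [add_sub_add_left_eq_sub, ← sub_smul, norm_smul, Real.norm_eq_abs]

theorem norm_normalProj_sub_le (hξ : IsNearestPath M p v ξ) (hC : IsC2Submanifold d M)
    (hτ : 0 < τ) (hF : HasTangentBound τ M) (hp : p ∈ M) (hvτ : ‖v‖ ≤ τ / 2)
    {t s : ℝ} (ht : t ∈ Icc (0 : ℝ) 1) (hs : s ∈ Icc (0 : ℝ) 1) :
    ‖normalProj M (ξ t) (ξ s - ξ t)‖ ≤ 2 * (s - t) ^ 2 * ‖v‖ ^ 2 / τ := by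
  refine (hF _ (hξ.mem t) _ (hξ.mem s)).trans ?_
  have h1 := pow_le_pow_left₀ (norm_nonneg _) (hξ.norm_sub_le hC hτ hF hp hvτ ht hs) 2
  rw [mul_pow, mul_pow, sq_abs] at h1
  rw [div_le_div_iff₀ (by positivity) hτ]
  nlinarith

/-- The nearest point moves with a velocity close to the tangential part of `v`. -/
theorem norm_tangentProj_sub_le (hξ : IsNearestPath M p v ξ) (hM : IsClosed M)
    (hC : IsC2Submanifold d M) (hτ : 0 < τ) (hF : HasTangentBound τ M) (hp : p ∈ M)
    (hv : ‖normalProj M p v‖ ≤ ‖v‖ ^ 2 / (2 * τ)) (hvτ : ‖v‖ ≤ τ / 2)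
    {t s : ℝ} (ht : t ∈ Icc (0 : ℝ) 1) (hs : s ∈ Icc (0 : ℝ) 1) :
    ‖tangentProj M (ξ t) (ξ s - ξ t) - (s - t) • tangentProj M (ξ t) v‖ ≤
      84 * (|s - t| * (‖v‖ ^ 3 / τ ^ 2)) := by
  -- The residuals at times `t` and `s` are normal at `ξ t` and `ξ s`. So the discrepancy of
  -- velocities is the change of tangent projection applied to a residual of size `O(‖v‖² / τ)`,
  -- giving `14 * 2 * 3 = 84`.
  have h0 : tangentProj M (ξ t) (p + t • v - ξ t) = 0 :=
    tangentProj_eq_zero (hC.sub_mem_normal_of_nearest (hξ.mem t) (hξ.infDist_eq t))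
  have h1 : tangentProj M (ξ s) (p + s • v - ξ s) = 0 :=
    tangentProj_eq_zero (hC.sub_mem_normal_of_nearest (hξ.mem s) (hξ.infDist_eq s))
  have h2 : tangentProj M (ξ t) (ξ s - ξ t) - (s - t) • tangentProj M (ξ t) v =
      (tangentProj M (ξ s) - tangentProj M (ξ t)) (p + s • v - ξ s) := by
    rw [sub_apply, h1, zero_sub, ← map_smul, ← map_sub]
    rw [← sub_zero (-(tangentProj M (ξ t) (p + s • v - ξ s))), ← neg_zero, ← h0, ← map_neg,
      ← map_neg, ← map_sub]
    congr 1
    rw [sub_smul]; abel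
  rw [h2]
  refine (ContinuousLinearMap.le_opNorm _ _).trans ?_
  have h3 := ExposedManifold.norm_tangentProj_sub_le hM hC hτ hF (hξ.mem s) (hξ.mem t)
  have h4 := hξ.norm_sub_le hC hτ hF hp hvτ ht hs
  calc _ ≤ (14 / τ * (2 * (|s - t| * ‖v‖))) * (3 * ‖v‖ ^ 2 / τ) :=
        mul_le_mul (h3.trans (by gcongr)) (hξ.norm_sub_le_sq hM hC hτ hF hp hv hs)
          (norm_nonneg _) (by positivity)
    _ = _ := by field_simp; ring

theorem continuousOn (hξ : IsNearestPath M p v ξ) (hC : IsC2Submanifold d M)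
    (hτ : 0 < τ) (hF : HasTangentBound τ M) (hp : p ∈ M) (hvτ : ‖v‖ ≤ τ / 2) :
    ContinuousOn ξ (Icc 0 1) := by
  refine (LipschitzOnWith.of_dist_le_mul (K := ⟨2 * ‖v‖, by positivity⟩)
    fun s hs t ht => ?_).continuousOn
  rw [dist_eq_norm, Real.dist_eq]
  refine (hξ.norm_sub_le hC hτ hF hp hvτ ht hs).trans (le_of_eq ?_)
  change _ = 2 * ‖v‖ * |s - t|
  ring

/-- First-order expansion of the normal part (at `p`) of the tangential part (at `ξ t`) of `v`. -/
theorem norm_normalProj_tangentProj_sub_le (hξ : IsNearestPath M p v ξ) (hM : IsClosed M)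
    (hC : IsC2Submanifold d M) (hτ : 0 < τ) (hF : HasTangentBound τ M)
    (hII : HasLipschitzSecondFundamentalForm Λ M) (hΛ : 1 / τ ^ 2 ≤ Λ) (hp : p ∈ M)
    (hv : ‖normalProj M p v‖ ≤ ‖v‖ ^ 2 / (2 * τ)) (hvτ : ‖v‖ ≤ τ / 2)
    {t : ℝ} (ht : t ∈ Icc (0 : ℝ) 1) :
    ‖normalProj M p (tangentProj M (ξ t) v) - t • secondFundamentalForm M p v v‖ ≤
      1400 * (Λ * ‖v‖ ^ 3) * t := by
  have hξc := hξ.continuousOn hC hτ hF hp hvτ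
  have hPc : ContinuousOn (fun t => tangentProj M (ξ t)) (Icc 0 1) :=
    ContinuousOn.comp (g := tangentProj M) (t := M)
      (fun q hq => (hC.differentiableWithinAt_tangentProj hq).continuousWithinAt) hξc
      (fun s _ => hξ.mem s)
  -- The right difference quotients are compared with `II` at `ξ t`, then with `II` at `p`. The
  -- non-vanishing errors are `e3`, `e4`, `e5`, and `588 + 791 + 2 ≤ 1400`; `e1` and `e2` fit into
  -- the slack `2 * m`.
  have hmain := norm_image_sub_le_of_eventually (f := fun t =>
    normalProj M p (tangentProj M (ξ t) v) - t • secondFundamentalForm M p v v)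
    (K := 1400 * (Λ * ‖v‖ ^ 3)) ?_ ?_ ht
  · simpa [hξ.zero hp, normalProj_tangentProj] using hmain
  · exact ((normalProj M p).continuous.comp_continuousOn
      (hPc.clm_apply continuousOn_const)).sub (by fun_prop)
  intro t ht r hr
  have htc : t ∈ Icc (0 : ℝ) 1 := ⟨ht.1, ht.2.le⟩
  set a := ‖v‖ with ha
  have ha0 : 0 ≤ a := norm_nonneg v
  have hu : a ^ 3 / τ ^ 2 ≤ Λ * a ^ 3 := by
    have := mul_le_mul_of_nonneg_right hΛ (pow_nonneg ha0 3)
    rwa [one_div_mul_eq_div] at this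
  set D := fderivWithin ℝ (tangentProj M) M (ξ t) with hD
  set m := (r - 1400 * (Λ * a ^ 3)) / 2 with hm
  have hm0 : 0 < m := by rw [hm]; linarith
  have hlittle := (hasFDerivWithinAt_iff_isLittleO.1
    (hC.differentiableWithinAt_tangentProj (hξ.mem t)).hasFDerivWithinAt).def
    (show 0 < m / (2 * a ^ 2 + 1) by positivity)
  have hIcc : Icc (0 : ℝ) 1 ∈ 𝓝[>] t :=
    mem_of_superset (Ioc_mem_nhdsGT ht.2) fun s hs => ⟨ht.1.trans hs.1.le, hs.2⟩
  have hlim : Tendsto ξ (𝓝[>] t) (𝓝[M] (ξ t)) := by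
    refine tendsto_nhdsWithin_iff.2 ⟨?_, Eventually.of_forall hξ.mem⟩
    have h1 : Tendsto ξ (𝓝[Icc 0 1] t) (𝓝 (ξ t)) := hξc t htc
    exact h1.mono_left (nhdsWithin_le_iff.2 hIcc)
  have hsmall : ∀ᶠ s in 𝓝[>] t, ‖D‖ * (2 * a ^ 3 / τ) * (s - t) < m := by
    have : Tendsto (fun s => ‖D‖ * (2 * a ^ 3 / τ) * (s - t)) (𝓝[>] t) (𝓝 0) :=
      (Continuous.tendsto' (f := fun s => ‖D‖ * (2 * a ^ 3 / τ) * (s - t)) (by fun_prop) t 0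
        (by simp)).mono_left nhdsWithin_le_nhds
    exact this.eventually_lt_const hm0
  filter_upwards [hlim.eventually hlittle, hIcc, self_mem_nhdsWithin, hsmall]
    with s hs1 hs hst hs2
  have hδ : 0 < s - t := sub_pos.2 (mem_Ioi.1 hst)
  set δ := s - t with hδd
  have habs : |s - t| = δ := abs_of_pos hδ
  have hΔ : ‖ξ s - ξ t‖ ≤ 2 * (δ * a) := habs ▸ hξ.norm_sub_le hC hτ hF hp hvτ htc hs
  have hΔN := hξ.norm_normalProj_sub_le hC hτ hF hp hvτ htc hs
  have hΔT := hξ.norm_tangentProj_sub_le hM hC hτ hF hp hv hvτ htc hs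
  rw [habs] at hΔT
  have hξp : ‖ξ t - p‖ ≤ 2 * a := by
    have := hξ.norm_sub_le hC hτ hF hp hvτ (left_mem_Icc.2 zero_le_one) htc
    rw [hξ.zero hp, sub_zero, abs_of_nonneg ht.1] at this
    refine this.trans ?_
    have := mul_le_of_le_one_left ha0 ht.2.le
    linarith
  have hPP : ‖tangentProj M (ξ t) - tangentProj M p‖ ≤ 28 * a / τ := by
    refine (ExposedManifold.norm_tangentProj_sub_le hM hC hτ hF (hξ.mem t) hp).trans ?_
    refine (mul_le_mul_of_nonneg_left hξp (by positivity)).trans (le_of_eq ?_)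
    ring
  have hDT : ∀ w ∈ tangentSpace M (ξ t), ‖D w‖ ≤ 14 / τ * ‖w‖ := fun w hw =>
    norm_fderivWithin_tangentProj_le hM hC hτ hF (hξ.mem t) hw
  have hDv : ‖D (tangentProj M (ξ t) v)‖ ≤ 14 / τ * a :=
    (hDT _ (tangentProj_mem _ _)).trans
      (mul_le_mul_of_nonneg_left (norm_tangentProj_le _ _) (by positivity))
  have hNv : ‖normalProj M (ξ t) v‖ ≤ 57 / 2 * a ^ 2 / τ := by
    have h1 : normalProj M (ξ t) v =
        normalProj M p v - (tangentProj M (ξ t) - tangentProj M p) v := by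
      rw [normalProj_apply, normalProj_apply, sub_apply]; abel
    rw [h1]
    refine (_root_.norm_sub_le _ _).trans ?_
    have h2 := (ContinuousLinearMap.le_opNorm (tangentProj M (ξ t) - tangentProj M p) v).trans
      (mul_le_mul_of_nonneg_right hPP ha0)
    have h3 : a ^ 2 / (2 * τ) + 28 * a / τ * a = 57 / 2 * a ^ 2 / τ := by field_simp; ring
    linarith
  have e1 : ‖(tangentProj M (ξ s) - tangentProj M (ξ t) - D (ξ s - ξ t)) v‖ ≤ m * δ := by
    refine (ContinuousLinearMap.le_opNorm _ _).trans ?_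
    calc _ ≤ m / (2 * a ^ 2 + 1) * (2 * (δ * a)) * a :=
          mul_le_mul_of_nonneg_right (hs1.trans (by gcongr)) ha0
      _ = m * δ * (2 * a ^ 2 / (2 * a ^ 2 + 1)) := by ring
      _ ≤ m * δ * 1 := by
          gcongr
          rw [div_le_one (by positivity)]; linarith
      _ = m * δ := mul_one _
  -- On normal vectors `D` has no uniform bound, but the normal displacement is quadratic in `δ`, so
  -- any finite `‖D‖` is harmless as `s → t`.
  have e2 : ‖D (normalProj M (ξ t) (ξ s - ξ t)) v‖ ≤ m * δ := by
    calc _ ≤ ‖D‖ * (2 * δ ^ 2 * a ^ 2 / τ) * a :=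
          (ContinuousLinearMap.le_opNorm _ _).trans (mul_le_mul_of_nonneg_right
            ((ContinuousLinearMap.le_opNorm _ _).trans (by gcongr)) ha0)
      _ = ‖D‖ * (2 * a ^ 3 / τ) * δ * δ := by ring
      _ ≤ m * δ := mul_le_mul_of_nonneg_right hs2.le hδ.le
  have e3 : ‖D (tangentProj M (ξ t) (ξ s - ξ t) - δ • tangentProj M (ξ t) v) v‖ ≤
      588 * (Λ * a ^ 3) * δ := by
    have hmem : tangentProj M (ξ t) (ξ s - ξ t) - δ • tangentProj M (ξ t) v ∈
        tangentSpace M (ξ t) :=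
      Submodule.sub_mem _ (tangentProj_mem _ _) (Submodule.smul_mem _ _ (tangentProj_mem _ _))
    calc _ ≤ 14 / τ * (84 * (δ * (a ^ 3 / τ ^ 2))) * a :=
          (ContinuousLinearMap.le_opNorm _ _).trans (mul_le_mul_of_nonneg_right
            ((hDT _ hmem).trans (by gcongr)) ha0)
      _ ≤ 14 / τ * (84 * (δ * (a ^ 3 / τ ^ 2))) * (τ / 2) := by gcongr
      _ = 588 * (a ^ 3 / τ ^ 2) * δ := by field_simp; ring
      _ ≤ _ := by gcongr
  -- Two replacements: the normal projection at `p` by that at `ξ t`, costing `28 * 14 = 392`, and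
  -- the last argument `v` by its tangential part, costing `14 * 57 / 2 = 399`.
  have e4 : ‖normalProj M p (D (tangentProj M (ξ t) v) v) -
      secondFundamentalForm M (ξ t) v v‖ ≤ 791 * (Λ * a ^ 3) := by
    have h1 : normalProj M p (D (tangentProj M (ξ t) v) v) - secondFundamentalForm M (ξ t) v v =
        (tangentProj M (ξ t) - tangentProj M p) (D (tangentProj M (ξ t) v) v) +
        normalProj M (ξ t) (D (tangentProj M (ξ t) v) (normalProj M (ξ t) v)) := by
      rw [secondFundamentalForm_apply, ← hD, sub_apply]
      rw [normalProj_apply (M := M) (ξ t) v, map_sub, map_sub, normalProj_apply p,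
        normalProj_apply (ξ t) (D _ v)]
      abel
    rw [h1]
    refine (norm_add_le _ _).trans ?_
    have h2 : ‖(tangentProj M (ξ t) - tangentProj M p) (D (tangentProj M (ξ t) v) v)‖ ≤
        28 * a / τ * (14 / τ * a * a) :=
      (ContinuousLinearMap.le_opNorm _ _).trans (mul_le_mul hPP
        ((ContinuousLinearMap.le_opNorm _ _).trans (mul_le_mul_of_nonneg_right hDv ha0))
        (norm_nonneg _) (by positivity))
    have h3 : ‖normalProj M (ξ t) (D (tangentProj M (ξ t) v) (normalProj M (ξ t) v))‖ ≤
        14 / τ * a * (57 / 2 * a ^ 2 / τ) :=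
      (norm_normalProj_le _ _).trans ((ContinuousLinearMap.le_opNorm _ _).trans
        (mul_le_mul hDv hNv (norm_nonneg _) (by positivity)))
    have h4 : 28 * a / τ * (14 / τ * a * a) + 14 / τ * a * (57 / 2 * a ^ 2 / τ) =
        791 * (a ^ 3 / τ ^ 2) := by field_simp; ring
    linarith
  have e5 : ‖secondFundamentalForm M (ξ t) v v - secondFundamentalForm M p v v‖ ≤
      2 * (Λ * a ^ 3) := by
    have hΛ0 : 0 ≤ Λ := le_trans (by positivity) hΛ
    have h1 : ‖secondFundamentalForm M (ξ t) - secondFundamentalForm M p‖ ≤ Λ * (2 * a) :=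
      (hII _ (hξ.mem t) _ hp).trans (mul_le_mul_of_nonneg_left hξp hΛ0)
    change ‖(secondFundamentalForm M (ξ t) - secondFundamentalForm M p) v v‖ ≤ _
    refine (ContinuousLinearMap.le_opNorm₂ _ _ _).trans ?_
    rw [← ha]
    calc _ ≤ Λ * (2 * a) * a * a := by gcongr
      _ = _ := by ring
  have hdec : (normalProj M p (tangentProj M (ξ s) v) - s • secondFundamentalForm M p v v) -
      (normalProj M p (tangentProj M (ξ t) v) - t • secondFundamentalForm M p v v) =
      normalProj M p ((tangentProj M (ξ s) - tangentProj M (ξ t) - D (ξ s - ξ t)) v) +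
      normalProj M p (D (normalProj M (ξ t) (ξ s - ξ t)) v) +
      normalProj M p (D (tangentProj M (ξ t) (ξ s - ξ t) - δ • tangentProj M (ξ t) v) v) +
      δ • (normalProj M p (D (tangentProj M (ξ t) v) v) - secondFundamentalForm M (ξ t) v v) +
      δ • (secondFundamentalForm M (ξ t) v v - secondFundamentalForm M p v v) := by
    rw [normalProj_apply (M := M) (ξ t) (ξ s - ξ t)]
    simp only [map_sub, sub_apply, map_smul, smul_apply, smul_sub]
    rw [hδd, sub_smul s t (secondFundamentalForm M p v v)]
    abel
  rw [hdec]
  refine (norm_add_le _ _).trans ?_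
  have n1 := norm_add₄_le (a := normalProj M p
      ((tangentProj M (ξ s) - tangentProj M (ξ t) - D (ξ s - ξ t)) v))
    (b := normalProj M p (D (normalProj M (ξ t) (ξ s - ξ t)) v))
    (c := normalProj M p (D (tangentProj M (ξ t) (ξ s - ξ t) - δ • tangentProj M (ξ t) v) v))
    (d := δ • (normalProj M p (D (tangentProj M (ξ t) v) v) - secondFundamentalForm M (ξ t) v v))
  have n2 := (norm_normalProj_le (M := M) p _).trans e1
  have n3 := (norm_normalProj_le (M := M) p _).trans e2
  have n4 := (norm_normalProj_le (M := M) p _).trans e3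
  rw [norm_smul, Real.norm_of_nonneg hδ.le] at n1 ⊢
  have n5 := mul_le_mul_of_nonneg_left e4 hδ.le
  have n6 := mul_le_mul_of_nonneg_left e5 hδ.le
  have n7 : r * δ = m * δ + m * δ + 1400 * (Λ * a ^ 3) * δ := by rw [hm]; ring
  have n8 : 0 ≤ Λ * a ^ 3 * δ :=
    mul_nonneg ((by positivity : 0 ≤ a ^ 3 / τ ^ 2).trans hu) hδ.le
  rw [n7]
  linarith

/-- Second-order expansion of the normal part of the nearest point. -/
theorem norm_normalProj_sub_secondFundamentalForm_le (hξ : IsNearestPath M p v ξ)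
    (hM : IsClosed M) (hC : IsC2Submanifold d M) (hτ : 0 < τ) (hF : HasTangentBound τ M)
    (hII : HasLipschitzSecondFundamentalForm Λ M) (hΛ : 1 / τ ^ 2 ≤ Λ) (hp : p ∈ M)
    (hv : ‖normalProj M p v‖ ≤ ‖v‖ ^ 2 / (2 * τ)) (hvτ : ‖v‖ ≤ τ / 2) :
    ‖normalProj M p (ξ 1 - p) - (1 / 2 : ℝ) • secondFundamentalForm M p v v‖ ≤
      1500 * (Λ * ‖v‖ ^ 3) := by
  have hξc := hξ.continuousOn hC hτ hF hp hvτ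
  have hmain := norm_image_sub_le_of_eventually (f := fun t =>
    normalProj M p (ξ t - p) - (t ^ 2 / 2) • secondFundamentalForm M p v v)
    (K := 1500 * (Λ * ‖v‖ ^ 3)) ?_ ?_ (right_mem_Icc.2 zero_le_one)
  · simpa [hξ.zero hp] using hmain
  · exact ((normalProj M p).continuous.comp_continuousOn
      (hξc.sub continuousOn_const)).sub (by fun_prop)
  intro t ht r hr
  have htc : t ∈ Icc (0 : ℝ) 1 := ⟨ht.1, ht.2.le⟩
  set a := ‖v‖ with ha
  have ha0 : 0 ≤ a := norm_nonneg v
  have hu : a ^ 3 / τ ^ 2 ≤ Λ * a ^ 3 := by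
    have := mul_le_mul_of_nonneg_right hΛ (pow_nonneg ha0 3)
    rwa [one_div_mul_eq_div] at this
  have hu0 : 0 ≤ Λ * a ^ 3 := (by positivity : 0 ≤ a ^ 3 / τ ^ 2).trans hu
  set m := r - 1500 * (Λ * a ^ 3) with hm
  have hm0 : 0 < m := by rw [hm]; linarith
  set b := secondFundamentalForm M p v v with hb
  have hIcc : Icc (0 : ℝ) 1 ∈ 𝓝[>] t :=
    mem_of_superset (Ioc_mem_nhdsGT ht.2) fun s hs => ⟨ht.1.trans hs.1.le, hs.2⟩
  have hsmall : ∀ᶠ s in 𝓝[>] t, (2 * a ^ 2 / τ + ‖b‖ / 2) * (s - t) < m := by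
    have : Tendsto (fun s => (2 * a ^ 2 / τ + ‖b‖ / 2) * (s - t)) (𝓝[>] t) (𝓝 0) :=
      (Continuous.tendsto' (f := fun s => (2 * a ^ 2 / τ + ‖b‖ / 2) * (s - t)) (by fun_prop) t 0
        (by simp)).mono_left nhdsWithin_le_nhds
    exact this.eventually_lt_const hm0
  filter_upwards [hIcc, self_mem_nhdsWithin, hsmall] with s hs hst hs2
  have hδ : 0 < s - t := sub_pos.2 (mem_Ioi.1 hst)
  set δ := s - t with hδd
  have habs : |s - t| = δ := abs_of_pos hδ
  have hΔN := hξ.norm_normalProj_sub_le hC hτ hF hp hvτ htc hs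
  have hΔT := hξ.norm_tangentProj_sub_le hM hC hτ hF hp hv hvτ htc hs
  rw [habs] at hΔT
  have hG := hξ.norm_normalProj_tangentProj_sub_le hM hC hτ hF hII hΛ hp hv hvτ htc
  have hdec : (normalProj M p (ξ s - p) - (s ^ 2 / 2) • b) -
      (normalProj M p (ξ t - p) - (t ^ 2 / 2) • b) =
      normalProj M p (normalProj M (ξ t) (ξ s - ξ t)) +
      normalProj M p (tangentProj M (ξ t) (ξ s - ξ t) - δ • tangentProj M (ξ t) v) +
      δ • (normalProj M p (tangentProj M (ξ t) v) - t • b) + (-(δ ^ 2 / 2)) • b := by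
    have h1 : s ^ 2 / 2 = t ^ 2 / 2 + δ * t + δ ^ 2 / 2 := by rw [hδd]; ring
    rw [normalProj_apply (M := M) (ξ t) (ξ s - ξ t), h1]
    simp only [map_sub, map_smul, smul_sub, add_smul, neg_smul, mul_smul]
    abel
  rw [hdec]
  refine (norm_add₄_le).trans ?_
  rw [norm_smul, norm_smul, norm_neg, Real.norm_of_nonneg hδ.le,
    Real.norm_of_nonneg (by positivity : 0 ≤ δ ^ 2 / 2)]
  have n1 := (norm_normalProj_le (M := M) p _).trans hΔN
  have n2 := (norm_normalProj_le (M := M) p _).trans hΔT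
  have n3 : δ * ‖normalProj M p (tangentProj M (ξ t) v) - t • b‖ ≤ δ * (1400 * (Λ * a ^ 3)) := by
    refine mul_le_mul_of_nonneg_left (hG.trans ?_) hδ.le
    exact mul_le_of_le_one_right (by positivity) ht.2.le
  have n4 : 84 * (δ * (a ^ 3 / τ ^ 2)) ≤ 84 * (δ * (Λ * a ^ 3)) := by gcongr
  have n5 := mul_le_mul_of_nonneg_right hs2.le hδ.le
  have n6 : (2 * a ^ 2 / τ + ‖b‖ / 2) * δ * δ = 2 * δ ^ 2 * a ^ 2 / τ + δ ^ 2 / 2 * ‖b‖ := by ring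
  have n7 : r * δ = m * δ + 1500 * (Λ * a ^ 3) * δ := by rw [hm]; ring
  have n8 : 0 ≤ Λ * a ^ 3 * δ := mul_nonneg hu0 hδ.le
  rw [n7]
  linarith

end IsNearestPath

theorem exists_isNearestPath (hM : IsClosed M) (hp : p ∈ M) {x : EuclideanSpace ℝ (Fin n)}
    (hx : x ∈ M) (hxd : infDist (p + v) M = dist (p + v) x) :
    ∃ ξ, IsNearestPath M p v ξ ∧ ξ 1 = x := by
  have hex : ∀ t : ℝ, ∃ ξ ∈ M, infDist (p + t • v) M = dist (p + t • v) ξ := fun t =>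
    hM.exists_infDist_eq_dist ⟨p, hp⟩ _
  choose ξ hξ hξd using hex
  -- The chosen nearest point at time `1` need not be `x`, so the selection is overwritten there.
  refine ⟨Function.update ξ 1 x, ⟨fun t => ?_, fun t => ?_⟩, by simp⟩
  · rcases eq_or_ne t 1 with rfl | ht
    · simpa using hx
    · simpa [ht] using hξ t
  · rcases eq_or_ne t 1 with rfl | ht
    · simpa using hxd
    · simpa [ht] using hξd t

/-- Taylor expansion of `M` at `p`: the point of `M` nearest to `p + v`, for `v` almost tangent, is
`p + Π_p v + II_p(v, v) / 2` up to an error of third order. -/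
theorem norm_nearest_expansion_le (hM : IsClosed M) (hC : IsC2Submanifold d M) (hτ : 0 < τ)
    (hF : HasTangentBound τ M) (hII : HasLipschitzSecondFundamentalForm Λ M)
    (hΛ : 1 / τ ^ 2 ≤ Λ) (hp : p ∈ M)
    (hv : ‖normalProj M p v‖ ≤ ‖v‖ ^ 2 / (2 * τ)) (hvτ : ‖v‖ ≤ τ / 2)
    {x : EuclideanSpace ℝ (Fin n)} (hx : x ∈ M) (hxd : infDist (p + v) M = dist (p + v) x) :
    ‖normalProj M p (x - p) - (1 / 2 : ℝ) • secondFundamentalForm M p v v‖ ≤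
        1500 * (Λ * ‖v‖ ^ 3) ∧
      ‖tangentProj M p (x - p) - tangentProj M p v‖ ≤ 84 * (Λ * ‖v‖ ^ 3) := by
  obtain ⟨ξ, hξ, rfl⟩ := exists_isNearestPath hM hp hx hxd
  refine ⟨hξ.norm_normalProj_sub_secondFundamentalForm_le hM hC hτ hF hII hΛ hp hv hvτ, ?_⟩
  have h := hξ.norm_tangentProj_sub_le hM hC hτ hF hp hv hvτ (left_mem_Icc.2 zero_le_one)
    (right_mem_Icc.2 zero_le_one)
  rw [hξ.zero hp, sub_zero, one_smul, abs_one, one_mul] at h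
  refine h.trans (mul_le_mul_of_nonneg_left ?_ (by norm_num))
  have := mul_le_mul_of_nonneg_right hΛ (pow_nonneg (norm_nonneg v) 3)
  rwa [one_div_mul_eq_div] at this

end SecondOrder

/-! ### Tangent spaces and second fundamental form near `S` -/

section NearSubspace

variable {d n : ℕ} {M : Set (EuclideanSpace ℝ (Fin n))} {p v w : EuclideanSpace ℝ (Fin n)}
  {τ Λ ε h : ℝ} {S : Submodule ℝ (EuclideanSpace ℝ (Fin n))}

/-- `M` contains points close to the second-order Taylor polynomial at `p`. -/
theorem exists_mem_norm_sub_le (hM : IsClosed M) (hC : IsC2Submanifold d M) (hτ : 0 < τ)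
    (hF : HasTangentBound τ M) (hII : HasLipschitzSecondFundamentalForm Λ M)
    (hΛ : 1 / τ ^ 2 ≤ Λ) (hp : p ∈ M) (hv : v ∈ tangentSpace M p) (hvτ : ‖v‖ ≤ τ / 2) :
    ∃ x ∈ M, ‖x - p - v - (1 / 2 : ℝ) • secondFundamentalForm M p v v‖ ≤
      1584 * (Λ * ‖v‖ ^ 3) := by
  obtain ⟨x, hx, hxd⟩ := hM.exists_infDist_eq_dist ⟨p, hp⟩ (p + v)
  obtain ⟨h1, h2⟩ := norm_nearest_expansion_le hM hC hτ hF hII hΛ hp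
    (by rw [normalProj_eq_zero hv, norm_zero]; positivity) hvτ hx hxd
  refine ⟨x, hx, ?_⟩
  have h3 : x - p - v - (1 / 2 : ℝ) • secondFundamentalForm M p v v =
      (normalProj M p (x - p) - (1 / 2 : ℝ) • secondFundamentalForm M p v v) +
      (tangentProj M p (x - p) - tangentProj M p v) := by
    rw [normalProj_apply, tangentProj_eq_self hv]; abel
  rw [h3]
  exact (norm_add_le _ _).trans (by linarith)

theorem secondFundamentalForm_tangentProj (w : EuclideanSpace ℝ (Fin n)) :
    secondFundamentalForm M p (tangentProj M p w) (tangentProj M p w) =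
      secondFundamentalForm M p w w := by
  simp only [secondFundamentalForm_apply, tangentProj_tangentProj]

/-- If `M` is close to `S`, so are its tangent vectors and the values of its second fundamental
form; tested on vectors of a fixed length. -/
theorem norm_starProjection_orthogonal_le (hM : IsClosed M) (hC : IsC2Submanifold d M)
    (hτ : 0 < τ) (hF : HasTangentBound τ M) (hII : HasLipschitzSecondFundamentalForm Λ M)
    (hΛ : 1 / τ ^ 2 ≤ Λ) (hS : ∀ x ∈ M, ‖Sᗮ.starProjection x‖ ≤ ε) (hp : p ∈ M)
    (hv : v ∈ tangentSpace M p) (hvτ : ‖v‖ ≤ τ / 2) :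
    ‖Sᗮ.starProjection v‖ ≤ ε + 1584 * (Λ * ‖v‖ ^ 3) ∧
      ‖Sᗮ.starProjection (secondFundamentalForm M p v v)‖ ≤ 4 * ε + 3168 * (Λ * ‖v‖ ^ 3) := by
  obtain ⟨x, hx, h1⟩ := exists_mem_norm_sub_le hM hC hτ hF hII hΛ hp hv hvτ
  -- The quadratic term is even in `v`: `x - y` isolates `2 v`, while `(x - p) + (y - p)` isolates
  -- the second fundamental form.
  obtain ⟨y, hy, h2⟩ := exists_mem_norm_sub_le hM hC hτ hF hII hΛ hp (Submodule.neg_mem _ hv)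
    (by rwa [norm_neg])
  rw [norm_neg, map_neg, map_neg, neg_apply, neg_neg] at h2
  set b := secondFundamentalForm M p v v with hb
  set Q := Sᗮ.starProjection with hQ
  have hQle : ∀ u, ‖Q u‖ ≤ ‖u‖ := fun u => Submodule.norm_starProjection_apply_le _ u
  set e := x - p - v - (1 / 2 : ℝ) • b with he
  set f := y - p - -v - (1 / 2 : ℝ) • b with hf
  have e1 := (hQle e).trans h1
  have f1 := (hQle f).trans h2
  have hx' := hS x hx
  have hy' := hS y hy
  have hp' := hS p hp
  constructor
  · have h3 : (2 : ℝ) • v = (x - y) - (e - f) := by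
      rw [he, hf, two_smul]; abel
    have h4 : 2 * ‖Q v‖ ≤ (‖Q x‖ + ‖Q y‖) + (‖Q e‖ + ‖Q f‖) := by
      have h5 : 2 * ‖Q v‖ = ‖Q ((2 : ℝ) • v)‖ := by
        rw [map_smul, norm_smul, Real.norm_ofNat]
      rw [h5, h3, map_sub, map_sub, map_sub]
      exact (norm_sub_le _ _).trans (add_le_add (norm_sub_le _ _) (norm_sub_le _ _))
    linarith
  · have h3 : b = (x - p) + (y - p) - (e + f) := by
      have : b = (1 / 2 : ℝ) • b + (1 / 2 : ℝ) • b := by rw [← add_smul]; norm_num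
      rw [he, hf]; nth_rewrite 1 [this]; abel
    rw [h3, map_sub, map_add, map_add, map_sub, map_sub]
    have h4 := norm_sub_le (Q x) (Q p)
    have h5 := norm_sub_le (Q y) (Q p)
    have h6 := norm_add_le (Q x - Q p) (Q y - Q p)
    have h7 := norm_add_le (Q e) (Q f)
    have h8 := norm_sub_le (Q x - Q p + (Q y - Q p)) (Q e + Q f)
    linarith

/-- Homogeneity: the previous bounds are applied at length `h`, a free parameter that balances `ε`
against the Taylor error. -/
theorem norm_starProjection_orthogonal_tangent_le (hM : IsClosed M) (hC : IsC2Submanifold d M)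
    (hτ : 0 < τ) (hF : HasTangentBound τ M) (hII : HasLipschitzSecondFundamentalForm Λ M)
    (hΛ : 1 / τ ^ 2 ≤ Λ) (hS : ∀ x ∈ M, ‖Sᗮ.starProjection x‖ ≤ ε) (hp : p ∈ M)
    (hh : 0 < h) (hhτ : h ≤ τ / 2) (hv : v ∈ tangentSpace M p) :
    ‖Sᗮ.starProjection v‖ ≤ (ε + 1584 * (Λ * h ^ 3)) / h * ‖v‖ ∧
      ‖Sᗮ.starProjection (secondFundamentalForm M p v v)‖ ≤
        (4 * ε + 3168 * (Λ * h ^ 3)) / h ^ 2 * ‖v‖ ^ 2 := by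
  rcases (norm_nonneg v).eq_or_lt with h0 | h0
  · rw [norm_eq_zero.1 h0.symm]; simp
  set c := h / ‖v‖ with hc
  have hc0 : 0 < c := by positivity
  have hcv : ‖c • v‖ = h := by
    rw [norm_smul, Real.norm_of_nonneg hc0.le, hc]; field_simp
  obtain ⟨h1, h2⟩ := norm_starProjection_orthogonal_le hM hC hτ hF hII hΛ hS hp
    (Submodule.smul_mem _ c hv) (hcv.trans_le hhτ)
  rw [hcv, map_smul, norm_smul, Real.norm_of_nonneg hc0.le] at h1
  have h3 : secondFundamentalForm M p (c • v) (c • v) =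
      (c * c) • secondFundamentalForm M p v v := by
    rw [map_smul, map_smul, smul_apply, smul_smul]
  rw [hcv, h3, map_smul, norm_smul, Real.norm_of_nonneg (by positivity)] at h2
  constructor
  · refine le_of_mul_le_mul_left (h1.trans (le_of_eq ?_)) hc0
    rw [hc]; field_simp
  · refine le_of_mul_le_mul_left (h2.trans (le_of_eq ?_)) (mul_pos hc0 hc0)
    rw [hc]; field_simp

theorem norm_starProjection_orthogonal_normalProj_le (hM : IsClosed M)
    (hC : IsC2Submanifold d M) (hτ : 0 < τ) (hF : HasTangentBound τ M)
    (hII : HasLipschitzSecondFundamentalForm Λ M) (hΛ : 1 / τ ^ 2 ≤ Λ)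
    (hS : ∀ x ∈ M, ‖Sᗮ.starProjection x‖ ≤ ε) (hp : p ∈ M) (hh : 0 < h) (hhτ : h ≤ τ / 2)
    {x : EuclideanSpace ℝ (Fin n)} (hx : x ∈ M) (hxp : ‖x - p‖ ≤ h) :
    ‖Sᗮ.starProjection (normalProj M p (x - p))‖ ≤
      (2 * ε / h ^ 2 + 3084 * (Λ * h)) * ‖x - p‖ ^ 2 := by
  have hΛ0 : 0 < Λ := lt_of_lt_of_le (by positivity) hΛ
  have hε : 0 ≤ ε := (norm_nonneg _).trans (hS p hp)
  set w := x - p with hw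
  have hxw : p + w = x := by rw [hw]; abel
  -- The expansion is used with the chord itself as `v`: `p + w = x` is its own nearest point, and
  -- the chord bound supplies the near-tangency condition.
  obtain ⟨h1, -⟩ := norm_nearest_expansion_le (v := w) hM hC hτ hF hII hΛ hp (hF p hp x hx)
    (hxp.trans hhτ) hx (by rw [hxw, dist_self, infDist_zero_of_mem hx])
  obtain ⟨-, h2⟩ := norm_starProjection_orthogonal_tangent_le hM hC hτ hF hII hΛ hS hp hh hhτ
    (tangentProj_mem p w)
  rw [secondFundamentalForm_tangentProj] at h2
  rw [← hw] at h1
  set b := secondFundamentalForm M p w w with hb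
  have h3 : normalProj M p w = (1 / 2 : ℝ) • b + (normalProj M p w - (1 / 2 : ℝ) • b) := by abel
  rw [h3, map_add, map_smul]
  refine (norm_add_le _ _).trans ?_
  rw [norm_smul, Real.norm_of_nonneg (by norm_num : (0 : ℝ) ≤ 1 / 2)]
  have h4 := (Submodule.norm_starProjection_apply_le Sᗮ _).trans h1
  have h5 : ‖Sᗮ.starProjection b‖ ≤ (4 * ε + 3168 * (Λ * h ^ 3)) / h ^ 2 * ‖w‖ ^ 2 :=
    h2.trans (by gcongr; exact norm_tangentProj_le _ _)
  have h6 : Λ * ‖w‖ ^ 3 ≤ Λ * h * ‖w‖ ^ 2 := by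
    have : Λ * ‖w‖ ^ 3 = Λ * ‖w‖ * ‖w‖ ^ 2 := by ring
    rw [this]; gcongr
  have h7 : (4 * ε + 3168 * (Λ * h ^ 3)) / h ^ 2 * ‖w‖ ^ 2 =
      4 * ε / h ^ 2 * ‖w‖ ^ 2 + 3168 * (Λ * h * ‖w‖ ^ 2) := by field_simp
  have h8 : (2 * ε / h ^ 2 + 3084 * (Λ * h)) * ‖w‖ ^ 2 =
      4 * ε / h ^ 2 * ‖w‖ ^ 2 / 2 + 3084 * (Λ * h * ‖w‖ ^ 2) := by ring
  linarith

end NearSubspace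

/-! ### Correcting the normal and exposing the projection -/

section Exposed

variable {d n : ℕ} {M : Set (EuclideanSpace ℝ (Fin n))} {p ν : EuclideanSpace ℝ (Fin n)}
  {τ R Λ ε δ h : ℝ} {S : Submodule ℝ (EuclideanSpace ℝ (Fin n))}

/-- The normal `ν` can be corrected to a vector of `S` that is still normal to `M` at `p`. -/
theorem exists_normal_mem_subspace (hν : ν ∈ (tangentSpace M p)ᗮ) (hδ0 : 0 ≤ δ) (hδ : δ ≤ 1 / 2)
    (hT : ∀ v ∈ tangentSpace M p, ‖Sᗮ.starProjection v‖ ≤ δ * ‖v‖) :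
    ∃ s : EuclideanSpace ℝ (Fin n), ‖s‖ ≤ 2 * (‖ν‖ * δ) ∧ ‖S.starProjection ν - s‖ ≤ ‖ν‖ ∧
      S.starProjection ν - s ∈ S ∧ S.starProjection ν - s ∈ (tangentSpace M p)ᗮ := by
  -- A vector of `S` is normal to `M` at `p` exactly when it is orthogonal to `V`. So `s` removes
  -- the `V`-component; it is small because, for `s = Π_S v`, normality of `ν` gives `‖s‖² =
  -- -⟪Π_{Sᗮ} v, ν⟫`, with `‖v‖ ≤ 2‖s‖`.
  set V := (tangentSpace M p).map S.starProjection.toLinearMap with hV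
  have hVS : V ≤ S := by
    rintro _ ⟨v, -, rfl⟩
    exact Submodule.starProjection_apply_mem S v
  set s := V.starProjection (S.starProjection ν) with hs
  have hsV : s ∈ V := Submodule.starProjection_apply_mem V _
  have hdec : S.starProjection ν - s = Vᗮ.starProjection (S.starProjection ν) := by
    rw [Submodule.starProjection_orthogonal_val]
  have hmemS : S.starProjection ν - s ∈ S :=
    S.sub_mem (Submodule.starProjection_apply_mem S ν) (hVS hsV)
  refine ⟨s, ?_, ?_, hmemS, ?_⟩
  · obtain ⟨v, hv, hvs⟩ := hsV
    change S.starProjection v = s at hvs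
    have hsplit : S.starProjection v + Sᗮ.starProjection v = v :=
      Submodule.starProjection_add_starProjection_orthogonal v
    have h1 : ‖s‖ ^ 2 = -inner ℝ (Sᗮ.starProjection v) ν := by
      have h2 : inner ℝ (S.starProjection ν - s) s = 0 :=
        Submodule.starProjection_inner_eq_zero (K := V) _ _ (Submodule.starProjection_apply_mem V _)
      rw [inner_sub_left, real_inner_self_eq_norm_sq, sub_eq_zero] at h2
      have h3 : inner ℝ (S.starProjection ν) s = inner ℝ s ν := by
        rw [Submodule.inner_starProjection_left_eq_right,
          Submodule.starProjection_eq_self_iff.2 (hvs ▸ Submodule.starProjection_apply_mem S v),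
          real_inner_comm]
      have h4 : inner ℝ v ν = 0 := (Submodule.mem_orthogonal _ _).1 hν v hv
      rw [← h2, h3, ← hvs, eq_sub_of_add_eq hsplit, inner_sub_left, h4, zero_sub]
    have h5 : ‖v‖ ≤ 2 * ‖s‖ := by
      have h6 := norm_add_le (S.starProjection v) (Sᗮ.starProjection v)
      rw [hsplit, hvs] at h6
      have h7 := (hT v hv).trans (mul_le_mul_of_nonneg_right hδ (norm_nonneg v))
      linarith
    have h6 : ‖s‖ * ‖s‖ ≤ ‖s‖ * (2 * (‖ν‖ * δ)) := by
      have h7 := neg_le_of_abs_le (abs_real_inner_le_norm (Sᗮ.starProjection v) ν)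
      have h8 := mul_le_mul_of_nonneg_right (hT v hv) (norm_nonneg ν)
      have h9 := mul_le_mul_of_nonneg_left h5 (mul_nonneg hδ0 (norm_nonneg ν))
      nlinarith
    rcases (norm_nonneg s).eq_or_lt with h0 | h0
    · rw [← h0]; positivity
    · exact le_of_mul_le_mul_left h6 h0
  · rw [hdec]
    exact (Submodule.norm_starProjection_apply_le _ _).trans
      (Submodule.norm_starProjection_apply_le _ _)
  · rw [Submodule.mem_orthogonal']
    intro v hv
    rw [← Submodule.starProjection_eq_self_iff.2 hmemS,
      Submodule.inner_starProjection_left_eq_right, hdec]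
    exact Submodule.inner_left_of_mem_orthogonal (K := V) ⟨v, hv, rfl⟩
      (Submodule.starProjection_apply_mem _ _)

/-- If all points of `A` satisfy `‖x - q‖ ^ 2 ≤ 4 ⟪N, x - q⟫` with `‖N‖ ≤ R`, then `A` lies in a ball
of radius `2 * R` with `q` on its boundary. -/
theorem exists_closedBall_of_inner {A : Set (EuclideanSpace ℝ (Fin n))}
    {q N : EuclideanSpace ℝ (Fin n)} (hR : 0 < R) (hν : ‖ν‖ = R) (hN : ‖N‖ ≤ R)
    (hA : ∀ x ∈ A, ‖x - q‖ ^ 2 ≤ 4 * inner ℝ N (x - q)) :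
    ∃ z, A ⊆ closedBall z (2 * R) ∧ q ∈ frontier (closedBall z (2 * R)) := by
  obtain ⟨b, hb, hbA⟩ : ∃ b : EuclideanSpace ℝ (Fin n), ‖b‖ = 2 * R ∧
      ∀ x ∈ A, ‖x - q‖ ^ 2 ≤ 2 * inner ℝ b (x - q) := by
    rcases (norm_nonneg N).eq_or_lt with h0 | h0
    -- If `N = 0`, then `A` contains no point other than `q`; `ν` merely provides some vector of the
    -- required length.
    · refine ⟨(2 : ℝ) • ν, by rw [norm_smul, hν, Real.norm_ofNat], fun x hx => ?_⟩
      have h1 := hA x hx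
      rw [norm_eq_zero.1 h0.symm, inner_zero_left, mul_zero] at h1
      have h2 : x - q = 0 :=
        norm_eq_zero.1 (pow_eq_zero_iff two_ne_zero |>.1 (le_antisymm h1 (sq_nonneg _)))
      simp [h2]
    · refine ⟨(2 * R / ‖N‖) • N, ?_, fun x hx => ?_⟩
      · rw [norm_smul, Real.norm_of_nonneg (by positivity)]
        field_simp
      · have h1 := hA x hx
        have h2 : 0 ≤ inner ℝ N (x - q) := by nlinarith [sq_nonneg ‖x - q‖]
        have h3 : 2 ≤ 2 * R / ‖N‖ := by rw [le_div_iff₀ h0]; linarith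
        rw [real_inner_smul_left]
        nlinarith [mul_le_mul_of_nonneg_right h3 h2]
  refine ⟨q + b, fun x hx => ?_, ?_⟩
  · rw [mem_closedBall, dist_eq_norm, ← sub_sub]
    refine le_of_sq_le_sq ?_ (by positivity)
    rw [norm_sub_sq_real, hb, real_inner_comm]
    linarith [hbA x hx]
  · rw [frontier_closedBall _ (by positivity), mem_sphere, dist_eq_norm, sub_add_cancel_left,
      norm_neg, hb]

theorem two_inner_ge_of_mem_closedBall {z x : EuclideanSpace ℝ (Fin n)} (hz : ‖z - p‖ = R)
    (hx : x ∈ closedBall z R) : ‖x - p‖ ^ 2 ≤ 2 * inner ℝ (z - p) (x - p) := by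
  rw [mem_closedBall, dist_eq_norm, ← sub_sub_sub_cancel_right x z p] at hx
  have h1 := pow_le_pow_left₀ (norm_nonneg _) hx 2
  rw [norm_sub_sq_real (x - p) (z - p), hz, real_inner_comm] at h1
  linarith

theorem norm_starProjection_orthogonal_lt {r : ℝ} {x : EuclideanSpace ℝ (Fin n)}
    (hx : infEDist x (S : Set (EuclideanSpace ℝ (Fin n))) < ENNReal.ofReal r) :
    ‖Sᗮ.starProjection x‖ < r := by
  obtain ⟨y, hy, hxy⟩ := infEDist_lt_iff.1 hx
  rw [edist_lt_ofReal, dist_eq_norm] at hxy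
  refine lt_of_le_of_lt ?_ hxy
  have h1 : Sᗮ.starProjection x = Sᗮ.starProjection (x - y) := by
    rw [map_sub, Submodule.starProjection_orthogonal_apply_eq_zero hy, sub_zero]
  rw [h1]
  exact Submodule.norm_starProjection_apply_le _ _

/-- The projection of `M` to `S` is exposed at the projection of `p`, under numerical smallness
conditions at a scale `h`; here `δ` bounds the angle between the tangent spaces and `S`. -/
theorem exists_closedBall_projection (hM : IsClosed M) (hC : IsC2Submanifold d M) (hτ : 0 < τ)
    (hF : HasTangentBound τ M) (hII : HasLipschitzSecondFundamentalForm Λ M)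
    (hΛ : 1 / τ ^ 2 ≤ Λ) (hS : ∀ x ∈ M, ‖Sᗮ.starProjection x‖ ≤ ε) (hp : p ∈ M)
    (hR : 0 < R) (hνR : ‖ν‖ = R) (hν : ν ∈ (tangentSpace M p)ᗮ)
    (hball : ∀ x ∈ M, ‖x - p‖ ^ 2 ≤ 2 * inner ℝ ν (x - p))
    (hh : 0 < h) (hhτ : h ≤ τ / 2) (hδ : (ε + 1584 * (Λ * h ^ 3)) / h = δ) (hδ2 : δ ≤ 1 / 2)
    (hδh : R * δ ≤ h / 16) (hεh : 32 * (R * ε) ≤ h ^ 2) (hRh : 3084 * (R * Λ * h) ≤ 1 / 16) :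
    ∃ z, S.starProjection '' M ⊆ closedBall z (2 * R) ∧
      S.starProjection p ∈ frontier (closedBall z (2 * R)) := by
  have hε : 0 ≤ ε := (norm_nonneg _).trans (hS p hp)
  have hΛ0 : 0 < Λ := lt_of_lt_of_le (by positivity) hΛ
  have hδ0 : 0 ≤ δ := by rw [← hδ]; positivity
  obtain ⟨s, hs, hNle, hNS, hNT⟩ := exists_normal_mem_subspace hν hδ0 hδ2 fun v hv =>
    hδ ▸ (norm_starProjection_orthogonal_tangent_le hM hC hτ hF hII hΛ hS hp hh hhτ hv).1
  set N := S.starProjection ν - s with hN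
  rw [hνR] at hs hNle
  have hdiff : ν - N = Sᗮ.starProjection ν + s := by
    rw [hN, Submodule.starProjection_orthogonal_val]; abel
  have hQ : ∀ u, inner ℝ (Sᗮ.starProjection ν) u ≤ R * ‖Sᗮ.starProjection u‖ := fun u => by
    rw [Submodule.inner_starProjection_left_eq_right, ← hνR]
    exact real_inner_le_norm _ _
  have key : ∀ x ∈ M, inner ℝ (ν - N) (x - p) ≤ ‖x - p‖ ^ 2 / 4 := by
    intro x hx
    rcases le_or_gt ‖x - p‖ h with hxp | hxp
    -- Near `p` the correction pays off: `ν - N` is normal, so the first-order tangential part of `x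
    -- - p` drops out and every remaining term is quadratic.
    · have h1 : inner ℝ (ν - N) (x - p) = inner ℝ (ν - N) (normalProj M p (x - p)) := by
        rw [normalProj, ← Submodule.inner_starProjection_left_eq_right,
          Submodule.starProjection_eq_self_iff.2 (Submodule.sub_mem _ hν hNT)]
      have h2 := norm_starProjection_orthogonal_normalProj_le hM hC hτ hF hII hΛ hS hp hh hhτ
        hx hxp
      have h3 := hQ (normalProj M p (x - p))
      have h4 := real_inner_le_norm s (normalProj M p (x - p))
      have h5 : ‖s‖ * ‖normalProj M p (x - p)‖ ≤ h / 8 * (‖x - p‖ ^ 2 / (2 * τ)) :=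
        mul_le_mul (by linarith) (hF p hp x hx) (norm_nonneg _) (by positivity)
      have h6 : h / 8 * (‖x - p‖ ^ 2 / (2 * τ)) ≤ ‖x - p‖ ^ 2 / 8 := by
        calc _ ≤ τ / 2 / 8 * (‖x - p‖ ^ 2 / (2 * τ)) := by gcongr
          _ = ‖x - p‖ ^ 2 / 32 := by field_simp; ring
          _ ≤ _ := by linarith [sq_nonneg ‖x - p‖]
      have h7 : R * ((2 * ε / h ^ 2 + 3084 * (Λ * h)) * ‖x - p‖ ^ 2) ≤ 1 / 8 * ‖x - p‖ ^ 2 := by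
        rw [← mul_assoc]
        refine mul_le_mul_of_nonneg_right ?_ (sq_nonneg _)
        have h8 : 2 * (R * ε) / h ^ 2 ≤ 1 / 16 := by
          rw [div_le_iff₀ (by positivity)]; linarith
        have h9 : R * (2 * ε / h ^ 2 + 3084 * (Λ * h)) =
            2 * (R * ε) / h ^ 2 + 3084 * (R * Λ * h) := by ring
        rw [h9]; linarith
      have h8 := mul_le_mul_of_nonneg_left h2 hR.le
      rw [h1, hdiff, inner_add_left]
      linarith
    · have h1 : ‖Sᗮ.starProjection (x - p)‖ ≤ 2 * ε := by
        rw [map_sub]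
        exact (norm_sub_le _ _).trans (by linarith [hS x hx, hS p hp])
      have h2 := hQ (x - p)
      have h3 := mul_le_mul_of_nonneg_left h1 hR.le
      have h4 := real_inner_le_norm s (x - p)
      have h5 : ‖s‖ * ‖x - p‖ ≤ h / 8 * ‖x - p‖ :=
        mul_le_mul_of_nonneg_right (by linarith) (norm_nonneg _)
      have h6 : h ^ 2 ≤ ‖x - p‖ ^ 2 := pow_le_pow_left₀ hh.le hxp.le 2
      have h7 : h * ‖x - p‖ ≤ ‖x - p‖ ^ 2 := by
        rw [sq]; exact mul_le_mul_of_nonneg_right hxp.le (norm_nonneg _)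
      rw [hdiff, inner_add_left]
      linarith [sq_nonneg ‖x - p‖]
  refine exists_closedBall_of_inner hR hνR hNle ?_
  rintro _ ⟨x, hx, rfl⟩
  rw [← map_sub]
  have h1 : inner ℝ N (S.starProjection (x - p)) = inner ℝ N (x - p) := by
    rw [← Submodule.inner_starProjection_left_eq_right,
      Submodule.starProjection_eq_self_iff.2 hNS]
  have h2 := key x hx
  have h3 := hball x hx
  have h4 := pow_le_pow_left₀ (norm_nonneg _) (Submodule.norm_starProjection_apply_le S (x - p)) 2
  rw [inner_sub_left] at h2
  rw [h1]
  linarith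

end Exposed

end ExposedManifold

end

/-! ### Choice of constants -/

theorem lemmal :
    ∃ c : ℝ, 0 < c ∧
      ∀ (n d : ℕ) (M : Set (EuclideanSpace ℝ (Fin n))) (τ R Λ : ℝ)
        (S : Submodule ℝ (EuclideanSpace ℝ (Fin n))),
        IsClosed M → ExposedManifold.IsC2Submanifold d M →
        0 < τ → 0 < R →
        ENNReal.ofReal τ ≤ ExposedManifold.reach M →
        ExposedManifold.IsExposed R M →
        ExposedManifold.HasLipschitzSecondFundamentalForm Λ M →
        τ ^ (-2 : ℤ) ≤ Λ →
        (⨆ x ∈ M, Metric.infEDist x (S : Set (EuclideanSpace ℝ (Fin n)))) <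
          ENNReal.ofReal (c * Λ ^ (-2 : ℤ) * R ^ (-4 : ℤ) * τ) →
        ExposedManifold.IsExposed (2 * R) (S.starProjection '' M) := by
  refine ⟨1 / 10 ^ 12, by positivity, ?_⟩
  intro n d M τ R Λ S hM hC hτ hR hreach hexp hII hΛ' hdist
  rintro _ ⟨p, hp, rfl⟩
  obtain ⟨z, hMz, hpz⟩ := hexp p hp
  rw [frontier_closedBall _ hR.ne', mem_sphere, dist_comm, dist_eq_norm] at hpz
  have hball : ∀ x ∈ M, ‖x - p‖ ^ 2 ≤ 2 * inner ℝ (z - p) (x - p) := fun x hx =>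
    ExposedManifold.two_inner_ge_of_mem_closedBall hpz (hMz hx)
  by_cases hsub : M.Subsingleton
  -- A single point has infinite reach, so `τ ≤ R`, needed below, can fail; this case is treated
  -- separately.
  · refine ExposedManifold.exists_closedBall_of_inner (N := z - p) hR hpz hpz.le ?_
    rintro _ ⟨x, hx, rfl⟩
    simp [hsub hx hp]
  have hΛ : 1 / τ ^ 2 ≤ Λ := by
    rw [one_div, ← zpow_natCast, ← zpow_neg]; exact_mod_cast hΛ'
  have hΛ0 : 0 < Λ := lt_of_lt_of_le (by positivity) hΛ
  have hΛτ : 1 ≤ Λ * τ ^ 2 := by rwa [div_le_iff₀ (by positivity)] at hΛ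
  have hF := ExposedManifold.hasTangentBound_of_reach hM hC hτ hreach
  have hν : z - p ∈ (ExposedManifold.tangentSpace M p)ᗮ := by
    rw [← neg_neg (z - p)]
    refine Submodule.neg_mem _ (hC.mem_normal_of_inner_le hp (K := 0) fun q hq => ?_)
    rw [inner_neg_left]
    linarith [hball q hq, sq_nonneg ‖q - p‖]
  -- At any second point of `M`, the exposing ball forces curving towards `z` at rate at least `1 /
  -- R`, while the chord bound allows at most `1 / τ`.
  have hτR : τ ≤ R := by
    obtain ⟨x, hx, hxp⟩ : ∃ x ∈ M, x ≠ p := by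
      by_contra! hne
      exact hsub fun x hx y hy => (hne x hx).trans (hne y hy).symm
    have h1 := (hball x hx).trans (mul_le_mul_of_nonneg_left
      (ExposedManifold.inner_le_of_mem_normal hF hp hν hx) zero_le_two)
    have h2 : 0 < ‖x - p‖ ^ 2 := pow_pos (norm_pos_iff.2 (sub_ne_zero.2 hxp)) 2
    rw [hpz] at h1
    have h3 : 2 * (R * (‖x - p‖ ^ 2 / (2 * τ))) = R / τ * ‖x - p‖ ^ 2 := by field_simp
    rw [h3] at h1
    have h4 : 1 ≤ R / τ := le_of_mul_le_mul_right (by rwa [one_mul]) h2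
    rwa [one_le_div hτ] at h4
  set ε := 1 / 10 ^ 12 * Λ ^ (-2 : ℤ) * R ^ (-4 : ℤ) * τ with hε
  have hS : ∀ x ∈ M, ‖Sᗮ.starProjection x‖ ≤ ε := fun x hx =>
    (ExposedManifold.norm_starProjection_orthogonal_lt
      ((le_iSup₂ (f := fun x (_ : x ∈ M) => infEDist x (S : Set (EuclideanSpace ℝ (Fin n))))
        x hx).trans_lt hdist)).le
  have hε' : ε * (10 ^ 12 * Λ ^ 2 * R ^ 4) = τ := by
    rw [hε, zpow_neg, zpow_neg]
    norm_cast
    field_simp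
  have hε0 : 0 < ε := by positivity
  -- The Taylor error requires `R * Λ * h` to be small, which fixes `h`. Then `R * ε ≤ h² / 100`
  -- follows from `c = 10⁻¹²` and `τ ≤ R`, while `Λ * τ² ≥ 1` and `τ ≤ R` give `h ≤ τ / 10⁵`.
  set h := 1 / (10 ^ 5 * (R * Λ)) with hh
  have hh0 : 0 < h := by positivity
  have hRΛh : R * Λ * h = 1 / 10 ^ 5 := by rw [hh]; field_simp
  have hhτ : h ≤ τ / 10 ^ 5 := by
    rw [hh, div_le_div_iff₀ (by positivity) (by positivity)]
    have : 1 ≤ R * Λ * τ := by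
      calc 1 ≤ Λ * τ ^ 2 := hΛτ
        _ = τ * Λ * τ := by ring
        _ ≤ R * Λ * τ := by gcongr
    linarith
  have hεh : 32 * (R * ε) ≤ h ^ 2 := by
    have h1 : h ^ 2 * (10 ^ 10 * (R * Λ) ^ 2) = 1 := by rw [hh]; field_simp
    have h2 : R * ε * (10 ^ 12 * (R * Λ) ^ 2) ≤ 1 := by
      have h3 : R * ε * (10 ^ 12 * (R * Λ) ^ 2) * R = τ := by rw [← hε']; ring
      refine le_of_mul_le_mul_right ?_ hR
      rw [h3, one_mul]; exact hτR
    have h4 : 0 < (R * Λ) ^ 2 := by positivity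
    refine le_of_mul_le_mul_right ?_ (by positivity : 0 < 10 ^ 12 * (R * Λ) ^ 2)
    linarith
  have hδh : R * ((ε + 1584 * (Λ * h ^ 3)) / h) ≤ h / 16 := by
    have h1 : R * ((ε + 1584 * (Λ * h ^ 3)) / h) = R * ε / h + 1584 * (R * Λ * h * h) := by
      field_simp
    have h2 : R * ε / h ≤ h / 32 := by
      rw [div_le_iff₀ hh0]; linarith [sq h]
    rw [h1, hRΛh]
    linarith
  refine ExposedManifold.exists_closedBall_projection hM hC hτ hF hII hΛ hS hp hR hpz hν hball
    hh0 (by linarith) rfl ?_ hδh hεh (by rw [hRΛh]; norm_num)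
  refine le_of_mul_le_mul_left (hδh.trans ?_) hR
  linarith
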